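/- Let $r\ge 2$ and $\kappa\ge 0$ be constant integers. There is a deterministic $\mathsf{CONGEST}$ algorithm that computes a $(2,r)$-ruling set in $O(\Delta^{2/(r+2)})+\log^* n$ rounds. In detail: there are a deterministic distributed algorithm $\mathcal A$ and constants $K,B$, depending only on $r$ and $\kappa$, such that the following holds for every finite simple graph $G=(V,E)$ with $n$ nodes and maximum degree at most $\Delta$, and every proper coloring of $G$ with $m\le n^{\kappa}$ colors given as input (for example, unique node identifiers of $O(\log n)$ bits). The nodes communicate over the edges of $G$ in synchronous rounds; in each round every node may send one message to each of its neighbors. Initially a node knows only $m$, $\Delta$, its own degree and its own input color; it distinguishes its neighbors by an arbitrary local port numbering, and local computation is unrestricted. When $\mathcal A$ is run on $G$, every message has at most $B\log_2 n$ bits, and after at most $$K\,\Delta^{2/(r+2)}+\log^* n$$ rounds every node has terminated and has decided whether it belongs to a set $S\subseteq V$, where $S$ is a $(2,r)$-ruling set of $G$: no two nodes of $S$ are adjacent, and every $v\in V$ has a node of $S$ in hop distance at most $r$. Here $\log^* n$ is the least number of times $\log_2$ must be applied, starting from $n$, to reach a value at most $1$. -/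

import Mathlib

/-- The iterated logarithm `log* n`: the least number of applications of `log₂`, starting from `n`,
after which the value is at most `1`. -/
noncomputable def logStar (n : ℕ) : ℕ :=
  sInf {k : ℕ | (Real.logb 2)^[k] (n : ℝ) ≤ 1}

/-- A deterministic synchronous message-passing algorithm that computes one bit per node.
It is run by every node of the network; local computation is unrestricted. A node sees its
neighbors only through ports `0, …, d - 1`, where `d` is its degree. Messages are bit strings. -/
structure DistAlgorithm where
  /-- local states of a node -/
  State : Type
  /-- `init m Δ d c` is the initial state of a node of degree `d` with input color `c`, where the
  number `m` of input colors and the degree bound `Δ` are known to all nodes -/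
  init : (m Δ d : ℕ) → Fin m → State
  /-- `send d x i` is the message that a node of degree `d` in state `x` sends through port `i` -/
  send : (d : ℕ) → State → Fin d → List Bool
  /-- `receive d x M` is the next state of a node of degree `d` in state `x` that receives the
  message `M i` through port `i`, for every `i` -/
  receive : (d : ℕ) → State → (Fin d → List Bool) → State
  /-- `some b` if a node in this state has terminated with output `b`, and `none` otherwise -/
  output : State → Option Bool

/-- A port numbering: every node `v` numbers its neighbors by `0, …, deg v - 1`, in an arbitrary
way. -/
def PortNumbering {V : Type*} (G : SimpleGraph V) [G.LocallyFinite] : Type _ :=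
  (v : V) → Fin (G.degree v) ≃ G.neighborSet v

namespace DistAlgorithm

variable {V : Type*} (A : DistAlgorithm) (G : SimpleGraph V) [G.LocallyFinite]

/-- The message which node `v` sends through its port `i` when the nodes are in the states `s`.
A node that has terminated sends nothing (the empty string). -/
def message (s : V → A.State) (v : V) (i : Fin (G.degree v)) : List Bool :=
  if (A.output (s v)).isSome then [] else A.send (G.degree v) (s v) i

/-- One synchronous round. Node `v` receives through its port `i` the message that the neighbor
`w` behind this port sends through the port of `w` that leads to `v`. A node that has terminated
keeps its state. -/
def step (p : PortNumbering G) (s : V → A.State) : V → A.State := fun v =>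
  if (A.output (s v)).isSome then s v
  else A.receive (G.degree v) (s v) fun i =>
    A.message G s (p v i) ((p (p v i)).symm ⟨v, (p v i).2.symm⟩)

/-- The states of all nodes after `t` rounds, on the network `G` with ports `p`, input coloring
`c` with `m` colors and degree bound `Δ`. -/
def run (p : PortNumbering G) {m : ℕ} (c : V → Fin m) (Δ t : ℕ) : V → A.State :=
  (A.step G p)^[t] fun v => A.init m Δ (G.degree v) (c v)

/-- In this execution no message ever has more than `b` bits. -/
def MessageBitsLE (p : PortNumbering G) {m : ℕ} (c : V → Fin m) (Δ : ℕ) (b : ℝ) : Prop :=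
  ∀ (t : ℕ) (v : V) (i : Fin (G.degree v)),
    ((A.message G (A.run G p c Δ t) v i).length : ℝ) ≤ b

/-- In this execution all nodes have terminated after `T` rounds, and the nodes with output `true`
are exactly those of `S`. -/
def ComputesSetIn (p : PortNumbering G) {m : ℕ} (c : V → Fin m) (Δ T : ℕ) (S : Set V) : Prop :=
  ∀ v : V, ∃ b : Bool, A.output (A.run G p c Δ T v) = some b ∧ (b = true ↔ v ∈ S)

end DistAlgorithm

/-- `S` is a `(2, r)`-ruling set of `G`: it is independent, and every vertex has a vertex of `S`
in hop distance at most `r`. -/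
def IsTwoRulingSet {V : Type*} (G : SimpleGraph V) (r : ℕ) (S : Set V) : Prop :=
  G.IsIndepSet S ∧ ∀ v : V, ∃ s ∈ S, G.edist v s ≤ (r : ℕ∞)

/-! Put `t = roundScale r Δ`, which is `Δ ^ (2 / (r + 2))` rounded up. A proper coloring with at
most `b ^ r` colors, written in base `b`, yields a `(2, r)`-ruling set in `r * b` rounds. Phase `i`
sweeps over the values of digit `i`, and a node survives if no neighbor has survived before it.
Adjacent survivors then agree in that digit, and every node that drops out has a surviving neighbor.
After `r` phases adjacent survivors would have equal colors, so there are none (`Sparsified.succ`,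
`isTwoRulingSet_rulingRounds`). It remains to find a proper coloring with `O(t ^ r)` colors in `O(t)
+ log* n` rounds, so that `b = O(t)` suffices.

All coloring steps rest on polynomials over a prime field that agree in few points. Linial's color
reduction reaches `O(Δ ^ 8)` colors within `log* n` rounds (`properBelow_linialRound`,
`linialCount_spec`). Next, `O(t)` rounds split the nodes into `O(t)` classes, each oriented with
out-degree at most `β = Δ / t + 1` (`hasClasses_classRounds`). Finally the classes are colored one
after the other, two rounds each, with `q ^ 2` colors for a prime `q = O(max β t)`
(`ListColored.succ`). Since `Δ ^ 2 ≤ t ^ (r + 2)` and `r ≥ 2`, both `(Δ / t) ^ 2` and `t ^ 2` are at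
most `t ^ r`, hence `q ^ 2 = O(t ^ r)` (`fieldScale_sq_le`).

Messages are encoded node states, so they are short once all entries are polynomial in `n`. The
bound `Δ` may be far larger than `n`. The coloring is therefore run only when `b ^ r < m`, which
forces `Δ ≤ n ^ κ` (`exists_entry_bound`). -/

/-! ### Node states and their encoding -/

/-- The local data of a node. -/
structure NodeState where
  /-- current proper color -/
  col : ℕ
  /-- `0` while undecided, and `z + 1` if the node is in class `z` -/
  cls : ℕ
  /-- the time at which the node has chosen its class -/
  time : ℕ
  /-- the chosen vertical shift of the polynomial of the node -/
  shift : ℕ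
  /-- `0` while uncolored, and `c + 1` if the node has final color `c` -/
  fin : ℕ
  /-- the number of sparsification phases the node has survived -/
  lvl : ℕ

namespace NodeState

/-- A state as a single number. -/
def encode (s : NodeState) : ℕ :=
  Nat.pair s.col (Nat.pair s.cls (Nat.pair s.time (Nat.pair s.shift (Nat.pair s.fin s.lvl))))

/-- The state with a given code. -/
def decode (n : ℕ) : NodeState where
  col := n.unpair.1
  cls := n.unpair.2.unpair.1
  time := n.unpair.2.unpair.2.unpair.1
  shift := n.unpair.2.unpair.2.unpair.2.unpair.1
  fin := n.unpair.2.unpair.2.unpair.2.unpair.2.unpair.1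
  lvl := n.unpair.2.unpair.2.unpair.2.unpair.2.unpair.2

theorem decode_encode (s : NodeState) : decode s.encode = s := by
  simp [decode, encode]

/-- All entries are at most `N`. -/
structure Bounded (N : ℕ) (s : NodeState) : Prop where
  col : s.col ≤ N
  cls : s.cls ≤ N
  time : s.time ≤ N
  shift : s.shift ≤ N
  fin : s.fin ≤ N
  lvl : s.lvl ≤ N

theorem pair_lt_sq {a b K : ℕ} (ha : a < K) (hb : b < K) : Nat.pair a b < K ^ 2 :=
  (Nat.pair_lt_max_add_one_sq a b).trans_le (Nat.pow_le_pow_left (max_lt ha hb) 2)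

/-- Each of the five nested pairings squares the bound, which gives the exponent `32 = 2 ^ 5`. -/
theorem Bounded.encode_lt {N : ℕ} {s : NodeState} (h : s.Bounded N) :
    s.encode < (N + 1) ^ 32 := by
  have up : ∀ {a : ℕ} (k : ℕ), k ≠ 0 → a ≤ N → a < (N + 1) ^ k := fun k hk ha =>
    (Nat.lt_succ_of_le ha).trans_le (Nat.le_self_pow hk _)
  have h1 := pair_lt_sq (Nat.lt_succ_of_le h.fin) (Nat.lt_succ_of_le h.lvl)
  have h2 := pair_lt_sq (up 2 (by simp) h.shift) h1
  rw [← pow_mul] at h2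
  have h3 := pair_lt_sq (up _ (by simp) h.time) h2
  rw [← pow_mul] at h3
  have h4 := pair_lt_sq (up _ (by simp) h.cls) h3
  rw [← pow_mul] at h4
  have h5 := pair_lt_sq (up _ (by simp) h.col) h4
  rw [← pow_mul] at h5
  exact h5

end NodeState

/-- The number with given binary digits, least significant first. -/
def natOfBits (l : List Bool) : ℕ := l.foldr Nat.bit 0

theorem natOfBits_bits (n : ℕ) : natOfBits n.bits = n := by
  induction n using Nat.binaryRec' with
  | zero => simp [natOfBits]
  | bit b n h ih =>
    rw [Nat.bits_append_bit n b h]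
    simpa [natOfBits] using congrArg (Nat.bit b) ih

/-! ### Programs as lists of rounds, and their distributed execution -/

/-- What a node does in one round, given the states of its neighbors. -/
abbrev Round := NodeState → Multiset NodeState → NodeState

/-- The algorithm in which all nodes execute a list of rounds, where in every round every node
sends its state to all its neighbors. -/
abbrev DistAlgorithm.ofProgram (prog : ℕ → ℕ → List Round) (start : ℕ → ℕ → NodeState)
    (out : NodeState → Bool) : DistAlgorithm where
  State := List Round × NodeState
  init m Δ _ c := (prog m Δ, start Δ c)
  send _ x _ := x.2.encode.bits
  receive _ x M := match x with
    | ([], s) => ([], s)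
    | (R :: l, s) => (l, R s (Finset.univ.val.map fun i => NodeState.decode (natOfBits (M i))))
  output x := if x.1.isEmpty then some (out x.2) else none

section Exec

variable {V : Type*} (G : SimpleGraph V) [G.LocallyFinite]

/-- The effect of a round on the states of all nodes. -/
def Round.step (R : Round) (s : V → NodeState) : V → NodeState := fun v =>
  R (s v) ((G.neighborFinset v).val.map s)

/-- The effect of a list of rounds on the states of all nodes. -/
def execRounds (l : List Round) (s : V → NodeState) : V → NodeState :=
  l.foldl (fun s R => R.step G s) s

theorem execRounds_append (l l' : List Round) (s : V → NodeState) :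
    execRounds G (l ++ l') s = execRounds G l' (execRounds G l s) :=
  List.foldl_append

theorem execRounds_map_range_succ (R : ℕ → Round) (k : ℕ) (s : V → NodeState) :
    execRounds G ((List.range (k + 1)).map R) s =
      (R k).step G (execRounds G ((List.range k).map R) s) := by
  rw [List.range_succ, List.map_append, execRounds_append]
  rfl

theorem execRounds_flatMap_range_succ (L : ℕ → List Round) (k : ℕ) (s : V → NodeState) :
    execRounds G ((List.range (k + 1)).flatMap L) s =
      execRounds G (L k) (execRounds G ((List.range k).flatMap L) s) := by
  rw [List.range_succ, List.flatMap_append, execRounds_append]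
  simp

/-- A round sees the neighbor states only as a multiset, so the port numbering drops out of the
analysis. -/
theorem PortNumbering.map_univ {α : Type*} (p : PortNumbering G) (f : V → α) (v : V) :
    (Finset.univ.val.map fun i : Fin (G.degree v) => f (p v i)) =
      (G.neighborFinset v).val.map f := by
  have h : G.neighborFinset v =
      (Finset.univ : Finset (Fin (G.degree v))).map
        ((p v).toEmbedding.trans (Function.Embedding.subtype _)) := by
    ext w
    simp only [SimpleGraph.mem_neighborFinset, Finset.mem_map, Finset.mem_univ, true_and]
    constructor
    · intro hw
      exact ⟨(p v).symm ⟨w, hw⟩, by simp⟩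
    · rintro ⟨i, rfl⟩
      exact (p v i).2
  rw [h, Finset.map_val, Multiset.map_map]
  rfl

variable (prog : ℕ → ℕ → List Round) (start : ℕ → ℕ → NodeState) (out : NodeState → Bool)

/-- All nodes hold the same remaining list, so they terminate together and a running node never
meets a silent neighbor. Decoding a message thus always recovers the sender's state. -/
theorem DistAlgorithm.iterate_step_ofProgram (p : PortNumbering G) (t : ℕ) :
    ∀ (l : List Round) (s : V → NodeState),
      ((ofProgram prog start out).step G p)^[t] (fun v => (l, s v)) =
        fun v => (l.drop t, execRounds G (l.take t) s v) := by
  induction t with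
  | zero => exact fun l s => rfl
  | succ t ih =>
    intro l s
    rw [Function.iterate_succ_apply]
    cases l with
    | nil =>
      have : (ofProgram prog start out).step G p (fun v => ([], s v)) = fun v => ([], s v) := by
        funext v
        simp [step, ofProgram]
      rw [this, ih]
      simp
    | cons R l =>
      have : (ofProgram prog start out).step G p (fun v => (R :: l, s v)) =
          fun v => (l, R.step G s v) := by
        funext v
        simp only [step, ofProgram, message, List.isEmpty_cons, Bool.false_eq_true, if_false,
          Option.isSome_none, natOfBits_bits, NodeState.decode_encode, Round.step]
        rw [PortNumbering.map_univ G p s v]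
      rw [this, ih]
      simp [execRounds]

theorem DistAlgorithm.run_ofProgram (p : PortNumbering G) {m : ℕ} (c : V → Fin m) (Δ t : ℕ) :
    (ofProgram prog start out).run G p c Δ t =
      fun v => ((prog m Δ).drop t,
        execRounds G ((prog m Δ).take t) (fun v => start Δ (c v)) v) :=
  iterate_step_ofProgram G prog start out p t _ _

theorem DistAlgorithm.computesSetIn_ofProgram (p : PortNumbering G) {m : ℕ} (c : V → Fin m)
    (Δ : ℕ) :
    (ofProgram prog start out).ComputesSetIn G p c Δ (prog m Δ).length
      {v | out (execRounds G (prog m Δ) (fun v => start Δ (c v)) v) = true} := by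
  intro v
  rw [run_ofProgram]
  simp

/-- The round preserves the bound `N` on all entries of the state. -/
def Round.Preserves (N : ℕ) (R : Round) : Prop :=
  ∀ s M, NodeState.Bounded N s → NodeState.Bounded N (R s M)

theorem bounded_execRounds {N : ℕ} (l : List Round) (hl : ∀ R ∈ l, R.Preserves N) :
    ∀ s : V → NodeState, (∀ v, (s v).Bounded N) → ∀ v, (execRounds G l s v).Bounded N := by
  induction l with
  | nil => exact fun s hs => hs
  | cons R l ih =>
    intro s hs
    exact ih (fun R hR => hl R (List.mem_cons_of_mem _ hR)) _
      fun v => hl R List.mem_cons_self _ _ (hs v)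

theorem size_le_of_lt_pow {a N k : ℕ} (h : a < N ^ k) (hN : 2 ≤ N) :
    ((Nat.size a : ℕ) : ℝ) ≤ k * Real.logb 2 N + 1 := by
  have hN' : (0 : ℝ) < N := by positivity
  have hlog : 0 ≤ Real.logb 2 N :=
    Real.logb_nonneg (by norm_num) (by exact_mod_cast (by omega : 1 ≤ N))
  rcases hs : Nat.size a with _ | s
  · simp; positivity
  · have h1 : 2 ^ s ≤ a := Nat.lt_size.1 (by omega)
    have h2 : ((2 : ℝ) ^ s) ≤ (N : ℝ) ^ k := by exact_mod_cast h1.trans h.le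
    have h3 := Real.logb_le_logb_of_le (b := 2) (by norm_num) (by positivity) h2
    rw [Real.logb_pow, Real.logb_pow, Real.logb_self_eq_one (by norm_num)] at h3
    push_cast
    linarith

theorem DistAlgorithm.messageBitsLE_ofProgram (p : PortNumbering G) {m : ℕ} (c : V → Fin m)
    (Δ : ℕ) {N : ℕ} (hN : 1 ≤ N) (hprog : ∀ R ∈ prog m Δ, R.Preserves N)
    (hstart : ∀ v, (start Δ (c v)).Bounded N) :
    (ofProgram prog start out).MessageBitsLE G p c Δ (32 * Real.logb 2 (N + 1 : ℕ) + 1) := by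
  intro t v i
  rw [run_ofProgram]
  have hb : (execRounds G ((prog m Δ).take t) (fun v => start Δ (c v)) v).Bounded N :=
    bounded_execRounds G _ (fun R hR => hprog R (List.mem_of_mem_take hR)) _ hstart v
  have h := size_le_of_lt_pow hb.encode_lt (by omega)
  unfold message
  split_ifs
  · have : (0 : ℝ) ≤ Real.logb 2 (N + 1 : ℕ) :=
      Real.logb_nonneg (by norm_num) (by exact_mod_cast (by omega : 1 ≤ N + 1))
    simp only [List.length_nil, Nat.cast_zero]
    positivity
  · simpa [ofProgram, Nat.size_eq_bits_len] using h

end Exec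

/-! ### A family of polynomials with few coincidences -/

/-- The value at `x`, modulo `q`, of the monic polynomial of degree `d + 1` without constant term
whose other coefficients are the first `d` digits of `φ` in base `q`. -/
def digitPoly (q d φ x : ℕ) : ℕ :=
  (x ^ (d + 1) + ∑ i ∈ Finset.range d, (φ / q ^ i % q) * x ^ (i + 1)) % q

theorem digitPoly_lt {q : ℕ} (hq : 0 < q) (d φ x : ℕ) : digitPoly q d φ x < q := Nat.mod_lt _ hq

theorem mod_pow_eq_of_digits_eq {b a c : ℕ} (d : ℕ)
    (h : ∀ i < d, a / b ^ i % b = c / b ^ i % b) : a % b ^ d = c % b ^ d := by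
  induction d with
  | zero => simp [Nat.mod_one]
  | succ d ih =>
    rw [Nat.mod_pow_succ, Nat.mod_pow_succ, ih fun i hi => h i (by omega), h d (by omega)]

open Polynomial in
theorem card_filter_eval_eq_zero_le {q : ℕ} [Fact q.Prime] {P : (ZMod q)[X]} (hP : P ≠ 0) :
    ((Finset.range q).filter fun x : ℕ => P.eval (x : ZMod q) = 0).card ≤ P.natDegree := by
  classical
  refine le_trans ?_ (P.roots.toFinset_card_le.trans P.card_roots')
  refine Finset.card_le_card_of_injOn (fun x : ℕ => (x : ZMod q)) ?_ ?_
  · intro x hx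
    simpa [hP] using (Finset.mem_filter.1 hx).2
  · intro x hx y hy hxy
    have hx' := Finset.mem_range.1 (Finset.mem_filter.1 hx).1
    have hy' := Finset.mem_range.1 (Finset.mem_filter.1 hy).1
    have := (ZMod.natCast_eq_natCast_iff' x y q).1 hxy
    rwa [Nat.mod_eq_of_lt hx', Nat.mod_eq_of_lt hy'] at this

open Polynomial in
/-- Shifted polynomials of different numbers agree in at most `d` points. -/
theorem card_filter_digitPoly_add_eq_le {q : ℕ} (hq : q.Prime) {d φ ψ : ℕ} (hφ : φ < q ^ d)
    (hψ : ψ < q ^ d) (hne : φ ≠ ψ) (e e' : ℕ) :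
    ((Finset.range q).filter fun x =>
      (digitPoly q d φ x + e) % q = (digitPoly q d ψ x + e') % q).card ≤ d := by
  have : Fact q.Prime := ⟨hq⟩
  -- In the difference of the two polynomials the leading terms cancel. The shifts enter only the
  -- constant term, where the polynomials themselves contribute nothing, so they cannot cancel a
  -- difference of digits.
  set P : (ZMod q)[X] := ∑ i ∈ Finset.range d,
    C (((φ / q ^ i % q : ℕ) : ZMod q) - ((ψ / q ^ i % q : ℕ) : ZMod q)) * X ^ (i + 1) +
      C ((e : ZMod q) - (e' : ZMod q)) with hPdef
  have hdeg : P.natDegree ≤ d := by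
    refine natDegree_add_le_of_degree_le (natDegree_sum_le_of_forall_le _ _ fun i hi => ?_)
      ((natDegree_C _).trans_le (Nat.zero_le d))
    exact (natDegree_C_mul_X_pow_le _ _).trans (Finset.mem_range.1 hi)
  have hP : P ≠ 0 := by
    intro h0
    apply hne
    have := mod_pow_eq_of_digits_eq (b := q) (a := φ) (c := ψ) d fun i hi => by
      have hc : P.coeff (i + 1) = 0 := by rw [h0, coeff_zero]
      rw [hPdef, coeff_add, finsetSum_coeff, Finset.sum_eq_single i] at hc
      · rw [coeff_C_mul_X_pow, if_pos rfl, coeff_C, if_neg (by omega), add_zero, sub_eq_zero,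
          ZMod.natCast_eq_natCast_iff'] at hc
        simpa using hc
      · intro j _ hj
        rw [coeff_C_mul_X_pow, if_neg (by omega)]
      · intro hi'
        exact absurd (Finset.mem_range.2 hi) hi'
    rwa [Nat.mod_eq_of_lt hφ, Nat.mod_eq_of_lt hψ] at this
  refine le_trans (Finset.card_le_card ?_) ((card_filter_eval_eq_zero_le hP).trans hdeg)
  intro x hx
  rw [Finset.mem_filter] at hx ⊢
  refine ⟨hx.1, ?_⟩
  have h := (ZMod.natCast_eq_natCast_iff' _ _ q).2 hx.2
  simp only [digitPoly, Nat.cast_add, ZMod.natCast_mod, Nat.cast_sum, Nat.cast_mul, Nat.cast_pow]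
    at h
  rw [hPdef, eval_add, eval_finsetSum]
  simp only [eval_mul, eval_C, eval_pow, eval_X, sub_mul, Finset.sum_sub_distrib, ZMod.natCast_mod]
  linear_combination h

open Polynomial in
/-- Every value is taken at most `d + 1` times. -/
theorem card_filter_digitPoly_eq_le {q : ℕ} (hq : q.Prime) (d φ y : ℕ) :
    ((Finset.range q).filter fun x => digitPoly q d φ x = y).card ≤ d + 1 := by
  have : Fact q.Prime := ⟨hq⟩
  -- The monic leading term keeps the polynomial minus `y` nonzero even if all digits of `φ` vanish.
  set R : (ZMod q)[X] := ∑ i ∈ Finset.range d,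
    C ((φ / q ^ i % q : ℕ) : ZMod q) * X ^ (i + 1) - C (y : ZMod q) with hR
  have hRdeg : R.degree < ((d + 1 : ℕ) : WithBot ℕ) := by
    refine lt_of_le_of_lt (b := ((d : ℕ) : WithBot ℕ)) ?_ (by exact_mod_cast Nat.lt_succ_self d)
    rw [← natDegree_le_iff_degree_le]
    refine (natDegree_sub_le _ _).trans (max_le ?_ (by simp))
    refine natDegree_sum_le_of_forall_le _ _ fun i hi => ?_
    exact (natDegree_C_mul_X_pow_le _ _).trans (Finset.mem_range.1 hi)
  have hmon := monic_X_pow_add hRdeg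
  have hdeg : (X ^ (d + 1) + R).natDegree ≤ d + 1 :=
    natDegree_add_le_of_degree_le (natDegree_X_pow_le _)
      (natDegree_le_iff_degree_le.2 hRdeg.le)
  refine le_trans (Finset.card_le_card ?_) ((card_filter_eval_eq_zero_le hmon.ne_zero).trans hdeg)
  intro x hx
  rw [Finset.mem_filter] at hx ⊢
  refine ⟨hx.1, ?_⟩
  have h := congrArg (Nat.cast (R := ZMod q)) hx.2
  simp only [digitPoly, Nat.cast_add, ZMod.natCast_mod, Nat.cast_sum, Nat.cast_mul, Nat.cast_pow]
    at h
  rw [hR, eval_add, eval_sub, eval_finsetSum]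
  simp only [eval_mul, eval_C, eval_pow, eval_X, ZMod.natCast_mod]
  linear_combination h

/-- The smallest prime above `n`. -/
noncomputable def primeAbove (n : ℕ) : ℕ := sInf {p | p.Prime ∧ n < p}

theorem primeAbove_spec (n : ℕ) : (primeAbove n).Prime ∧ n < primeAbove n := by
  refine Nat.sInf_mem (s := {p | p.Prime ∧ n < p}) ?_
  obtain ⟨p, hp, hpp⟩ := Nat.exists_infinite_primes (n + 1)
  exact ⟨p, hpp, hp⟩

/-- This is Bertrand's postulate. -/
theorem primeAbove_le {n : ℕ} (hn : n ≠ 0) : primeAbove n ≤ 2 * n := by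
  obtain ⟨p, hp, h1, h2⟩ := Nat.exists_prime_lt_and_le_two_mul n hn
  exact (Nat.sInf_le (s := {p | p.Prime ∧ n < p}) ⟨hp, h1⟩).trans h2

theorem exists_lt_notMem_of_card_lt {q : ℕ} {s : Finset ℕ} (h : s.card < q) :
    ∃ x < q, x ∉ s := by
  obtain ⟨x, hx, hxs⟩ := Finset.exists_mem_notMem_of_card_lt_card (s := s)
    (t := Finset.range q) (by simpa using h)
  exact ⟨x, Finset.mem_range.1 hx, hxs⟩

theorem mul_add_inj {q x y x' y' : ℕ} (hy : y < q) (hy' : y' < q)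
    (h : x * q + y = x' * q + y') : x = x' ∧ y = y' := by
  have hq : 0 < q := by omega
  have h1 := congrArg (· / q) h
  have h2 := congrArg (· % q) h
  simp only [mul_comm _ q, Nat.mul_add_div hq, Nat.mul_add_mod, Nat.div_eq_of_lt hy,
    Nat.div_eq_of_lt hy', Nat.mod_eq_of_lt hy, Nat.mod_eq_of_lt hy', add_zero] at h1 h2
  exact ⟨h1, h2⟩

theorem mul_add_lt_sq {q x y : ℕ} (hx : x < q) (hy : y < q) : x * q + y < q ^ 2 := by nlinarith

/-! ### The rounds of the algorithm -/

/-- Color reduction: choose a point in which the own polynomial differs from the polynomials of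
all neighbors. -/
noncomputable def linialRound (q d : ℕ) : Round := fun s M =>
  let x := sInf {x | x < q ∧ ∀ u ∈ M, digitPoly q d u.col x ≠ digitPoly q d s.col x}
  { s with col := x * q + digitPoly q d s.col x }

/-- One plus the class that a node has chosen, or that it tries at time `x`. -/
def classValue (q d x : ℕ) (s : NodeState) : ℕ :=
  if s.cls = 0 then digitPoly q d s.col x + 1 else s.cls

/-- Choose the class that is tried at time `x` if it has at most `β` conflicts. -/
def classRound (q d β x : ℕ) : Round := fun s M =>
  if s.cls = 0 ∧ M.countP (fun u => classValue q d x u = classValue q d x s) ≤ β then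
    { s with cls := digitPoly q d s.col x + 1, time := x }
  else s

/-- The color that belongs to the point `x` of the shifted polynomial of a node. -/
def pointColor (q d x a : ℕ) (s : NodeState) : ℕ := x * q + (digitPoly q d s.col x + a) % q

/-- Nodes of class `j` choose a shift such that the shifted polynomial contains at most `Q` colors
of neighbors. -/
noncomputable def shiftRound (q d Q j : ℕ) : Round := fun s M =>
  if s.cls = j + 1 then
    { s with shift := sInf {a | a < q ∧ ((Finset.range q).filter fun x =>
        pointColor q d x a s + 1 ∈ M.map NodeState.fin).card ≤ Q} }
  else s

/-- Nodes of class `j` choose a point of their polynomial that is not the color of a neighbor and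
that does not lie on the polynomials of the out-neighbors in the same class. -/
noncomputable def pickRound (q d j : ℕ) : Round := fun s M =>
  if s.cls = j + 1 then
    let x := sInf {x | x < q ∧ pointColor q d x s.shift s + 1 ∉ M.map NodeState.fin ∧
      ∀ u ∈ M, u.cls = s.cls → u.time ≤ s.time →
        pointColor q d x u.shift u ≠ pointColor q d x s.shift s}
    { s with fin := pointColor q d x s.shift s + 1 }
  else s

/-- Use the final color as the current color. -/
def adoptRound : Round := fun s _ => { s with col := s.fin - 1 }

/-- In phase `i`, nodes with digit `j` survive if no neighbor has survived before. -/
def levelRound (b i j : ℕ) : Round := fun s M =>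
  if s.lvl = i ∧ s.col / b ^ i % b = j ∧ i + 1 ∉ M.map NodeState.lvl then
    { s with lvl := i + 1 }
  else s

/-! ### Color reduction and the arbdefective coloring -/

section Stages

variable {V : Type*} (G : SimpleGraph V) [G.LocallyFinite]

/-- The current colors are a proper coloring with colors below `m`. -/
def ProperBelow (m : ℕ) (s : V → NodeState) : Prop :=
  (∀ v, (s v).col < m) ∧ ∀ u v, G.Adj u v → (s u).col ≠ (s v).col

/-- Except for the current color, the states are the initial ones. -/
def Fresh (s : V → NodeState) : Prop :=
  ∀ v, (s v).cls = 0 ∧ (s v).fin = 0 ∧ (s v).lvl = 0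

theorem mem_neighborFinset_map {α : Type*} {f : V → α} {v : V} {a : α} :
    a ∈ (G.neighborFinset v).val.map f ↔ ∃ u, G.Adj v u ∧ f u = a := by
  simp

variable {G}

/-- Each neighbor spoils at most `d` points, so fewer than `q` in total, and a good point `x`
remains. The new color encodes the pair of `x` and its value: neighbors with equal new colors would
share a point that the choice of `x` excludes. -/
theorem properBelow_linialRound {s : V → NodeState} {q d Δ : ℕ} (hq : q.Prime)
    (hs : ProperBelow G (q ^ d) s) (hΔ : ∀ v, G.degree v ≤ Δ) (hqd : d * Δ < q) :
    ProperBelow G (q ^ 2) ((linialRound q d).step G s) := by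
  have key : ∀ v, ∃ x < q, ((linialRound q d).step G s v).col = x * q + digitPoly q d (s v).col x ∧
      ∀ u, G.Adj v u → digitPoly q d (s u).col x ≠ digitPoly q d (s v).col x := by
    intro v
    let S := {x | x < q ∧ ∀ u ∈ (G.neighborFinset v).val.map s,
      digitPoly q d u.col x ≠ digitPoly q d (s v).col x}
    have hmem : sInf S ∈ S := by
      apply Nat.sInf_mem
      have hcard : ((G.neighborFinset v).biUnion fun u => (Finset.range q).filter fun x =>
          (digitPoly q d (s u).col x + 0) % q = (digitPoly q d (s v).col x + 0) % q).card < q := by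
        refine lt_of_le_of_lt (Finset.card_biUnion_le_card_mul _ _ d fun u hu => ?_)
          (lt_of_le_of_lt ?_ hqd)
        · exact card_filter_digitPoly_add_eq_le hq (hs.1 u) (hs.1 v)
            (hs.2 u v ((G.mem_neighborFinset v u).1 hu).symm) 0 0
        · rw [mul_comm]
          exact Nat.mul_le_mul_left d (hΔ v)
      obtain ⟨x, hx, hxS⟩ := exists_lt_notMem_of_card_lt hcard
      refine ⟨x, hx, fun w hw h => hxS ?_⟩
      obtain ⟨u, hu, rfl⟩ := (mem_neighborFinset_map G).1 hw
      exact Finset.mem_biUnion.2 ⟨u, (G.mem_neighborFinset v u).2 hu,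
        Finset.mem_filter.2 ⟨Finset.mem_range.2 hx, by rw [h]⟩⟩
    exact ⟨sInf S, hmem.1, rfl, fun u hu => hmem.2 _ ((mem_neighborFinset_map G).2 ⟨u, hu, rfl⟩)⟩
  refine ⟨fun v => ?_, fun u v huv h => ?_⟩
  · obtain ⟨x, hx, hc, -⟩ := key v
    rw [hc]
    exact mul_add_lt_sq hx (digitPoly_lt hq.pos _ _ _)
  · obtain ⟨x, -, hc, -⟩ := key u
    obtain ⟨y, -, hc', hy⟩ := key v
    rw [hc, hc'] at h
    obtain ⟨rfl, h2⟩ := mul_add_inj (digitPoly_lt hq.pos _ _ _) (digitPoly_lt hq.pos _ _ _) h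
    exact hy u huv.symm h2

/-- The result of the arbdefective coloring: every node has one of `q` classes, and at most `β`
neighbors in the same class that were not later. -/
def HasClasses (G : SimpleGraph V) [G.LocallyFinite] (q β : ℕ) (s : V → NodeState) : Prop :=
  (∀ v, (s v).cls ≠ 0 ∧ (s v).cls ≤ q) ∧
    ∀ v, ((G.neighborFinset v).filter fun u =>
      (s u).cls = (s v).cls ∧ (s u).time ≤ (s v).time).card ≤ β

theorem classRound_step_apply (q d β x : ℕ) (s : V → NodeState) (v : V) :
    (classRound q d β x).step G s v =
      if (s v).cls = 0 ∧ ((G.neighborFinset v).filter fun u =>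
          classValue q d x (s u) = classValue q d x (s v)).card ≤ β then
        { s v with cls := digitPoly q d (s v).col x + 1, time := x }
      else s v := by
  simp only [Round.step, classRound, Multiset.countP_map]
  rfl

/-- A neighbor conflicts with an undecided node in at most `2 * d + 1` rounds: at most `d` while it
is undecided too, since the polynomials differ, and at most `d + 1` after it has fixed its class,
since a value is taken at most `d + 1` times. A node undecided in all `q` rounds would have met at
least `q * (β + 1)` conflicts, more than its neighbors can cause. Orienting each edge inside a class
towards the endpoint that was not later bounds the out-degree by the conflicts tolerated at the time
of choice. -/
theorem hasClasses_classRounds {s : V → NodeState} {q d β t Δ : ℕ} (hq : q.Prime)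
    (hs : ProperBelow G (q ^ d) s) (hfresh : Fresh s) (hΔ : ∀ v, G.degree v ≤ Δ)
    (hβ : Δ ≤ β * t) (hqt : (2 * d + 1) * t < q) :
    HasClasses G q β (execRounds G ((List.range q).map (classRound q d β)) s) ∧
      ∀ v, (execRounds G ((List.range q).map (classRound q d β)) s v).col = (s v).col ∧
        (execRounds G ((List.range q).map (classRound q d β)) s v).fin = (s v).fin ∧
        (execRounds G ((List.range q).map (classRound q d β)) s v).lvl = (s v).lvl := by
  set S : ℕ → V → NodeState := fun x => execRounds G ((List.range x).map (classRound q d β)) s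
    with hSdef
  have hS : ∀ x v, S (x + 1) v = if (S x v).cls = 0 ∧ ((G.neighborFinset v).filter fun u =>
          classValue q d x (S x u) = classValue q d x (S x v)).card ≤ β then
        { S x v with cls := digitPoly q d (S x v).col x + 1, time := x }
      else S x v := fun x v => by
    rw [← classRound_step_apply, hSdef]
    simp only
    rw [execRounds_map_range_succ]
  have hfix : ∀ x v, (S x v).col = (s v).col ∧ (S x v).fin = (s v).fin ∧
      (S x v).lvl = (s v).lvl := by
    intro x v
    induction x with
    | zero => exact ⟨rfl, rfl, rfl⟩
    | succ x ih => rw [hS]; split_ifs <;> exact ih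
  have hstay : ∀ x v, (S x v).cls ≠ 0 → S (x + 1) v = S x v := fun x v h => by
    rw [hS, if_neg fun h' => h h'.1]
  have hstay' : ∀ x v, (S x v).cls ≠ 0 → ∀ k, S (x + k) v = S x v := by
    intro x v h k
    induction k with
    | zero => rfl
    | succ k ih => rw [← add_assoc, hstay _ _ (by rwa [ih]), ih]
  have hle : ∀ x v, (S x v).cls ≤ q := by
    intro x v
    induction x with
    | zero => exact (hfresh v).1.trans_le (Nat.zero_le q)
    | succ x ih =>
      rw [hS]
      split_ifs
      · exact digitPoly_lt hq.pos _ _ _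
      · exact ih
  -- The strict bound on the time matters: a neighbor that joins the class in a later round `x` gets
  -- time `x`, so it never becomes an out-neighbor.
  have horient : ∀ x v, (S x v).cls ≠ 0 → (S x v).time < x ∧
      ((G.neighborFinset v).filter fun u =>
        (S x u).cls = (S x v).cls ∧ (S x u).time ≤ (S x v).time).card ≤ β := by
    intro x
    induction x with
    | zero => exact fun v h => absurd (hfresh v).1 h
    | succ x ih =>
      intro v hv
      by_cases h0 : (S x v).cls = 0
      · have hSv := hS x v
        split_ifs at hSv with hc
        · have hcls : (S (x + 1) v).cls = classValue q d x (S x v) := by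
            rw [hSv, classValue, if_pos h0]
          refine ⟨by rw [hSv]; exact Nat.lt_succ_self x, (Finset.card_le_card ?_).trans hc.2⟩
          intro u hu
          rw [Finset.mem_filter] at hu ⊢
          refine ⟨hu.1, ?_⟩
          rw [← hcls, ← hu.2.1]
          have hSu := hS x u
          split_ifs at hSu with hcu
          · rw [hSu, classValue, if_pos hcu.1]
          · rw [hSu, classValue, if_neg]
            rw [← hSu, hu.2.1]
            exact hv
        · exact absurd (by rw [hSv]; exact h0) hv
      · rw [hstay x v h0]
        obtain ⟨h1, h2⟩ := ih v h0
        refine ⟨h1.trans (Nat.lt_succ_self x), (Finset.card_le_card ?_).trans h2⟩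
        intro u hu
        rw [Finset.mem_filter] at hu ⊢
        refine ⟨hu.1, ?_⟩
        have hSu := hS x u
        split_ifs at hSu with hcu
        · have := hu.2.2
          rw [hSu] at this
          exact absurd h1 (not_lt.2 this)
        · rw [← hSu]
          exact hu.2
  have hdone : ∀ v, (S q v).cls ≠ 0 := by
    intro v hv
    have hund : ∀ x ≤ q, (S x v).cls = 0 := by
      intro x hx
      by_contra h
      have := hstay' x v h (q - x)
      rw [Nat.add_sub_cancel' hx] at this
      exact h (this ▸ hv)
    -- The same pairs of rounds and neighbors are counted twice: each failed round has at least `β +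
    -- 1` conflicts, and each neighbor conflicts in at most `2 * d + 1` rounds.
    have hmany : ∀ x < q, β + 1 ≤ ((G.neighborFinset v).filter fun u =>
        classValue q d x (S x u) = classValue q d x (S x v)).card := by
      intro x hx
      by_contra h
      have hSv := hS x v
      rw [if_pos ⟨hund x hx.le, by omega⟩] at hSv
      have := hund (x + 1) hx
      rw [hSv] at this
      exact Nat.succ_ne_zero _ this
    have hfew : ∀ u ∈ G.neighborFinset v, ((Finset.range q).filter fun x =>
        classValue q d x (S x u) = classValue q d x (S x v)).card ≤ 2 * d + 1 := by
      intro u hu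
      have hsub : ((Finset.range q).filter fun x =>
          classValue q d x (S x u) = classValue q d x (S x v)) ⊆
          ((Finset.range q).filter fun x =>
            (digitPoly q d (s u).col x + 0) % q = (digitPoly q d (s v).col x + 0) % q) ∪
          ((Finset.range q).filter fun x => digitPoly q d (s v).col x = (S q u).cls - 1) := by
        intro x hx
        rw [Finset.mem_filter] at hx
        have hxq := Finset.mem_range.1 hx.1
        have h := hx.2
        rw [classValue, classValue, if_pos (hund x hxq.le), (hfix x v).1, (hfix x u).1] at h
        rw [Finset.mem_union, Finset.mem_filter, Finset.mem_filter]
        split_ifs at h with hu0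
        · exact Or.inl ⟨hx.1, by rw [Nat.succ_injective h]⟩
        · refine Or.inr ⟨hx.1, ?_⟩
          have := hstay' x u hu0 (q - x)
          rw [Nat.add_sub_cancel' hxq.le] at this
          rw [this, h, Nat.add_sub_cancel]
      have h1 := card_filter_digitPoly_add_eq_le hq (hs.1 u) (hs.1 v)
        (hs.2 u v ((G.mem_neighborFinset v u).1 hu).symm) 0 0
      have h2 := card_filter_digitPoly_eq_le hq d (s v).col ((S q u).cls - 1)
      have h3 := (Finset.card_le_card hsub).trans (Finset.card_union_le _ _)
      omega
    have hcount := Finset.card_mul_le_card_mul (s := Finset.range q) (t := G.neighborFinset v)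
      (fun x u => classValue q d x (S x u) = classValue q d x (S x v))
      (m := β + 1) (n := 2 * d + 1) (fun x hx => hmany x (Finset.mem_range.1 hx)) hfew
    rw [Finset.card_range, G.card_neighborFinset_eq_degree] at hcount
    have h1 : q * (β + 1) ≤ (β * t) * (2 * d + 1) :=
      hcount.trans (Nat.mul_le_mul_right _ ((hΔ v).trans hβ))
    have h2 := hq.pos
    nlinarith
  exact ⟨⟨fun v => ⟨hdone v, hle q v⟩, fun v => (horient q v (hdone v)).2⟩, hfix q⟩

end Stages

/-! ### Coloring class after class -/

section ListColoring

variable {V : Type*} {G : SimpleGraph V} [G.LocallyFinite]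

theorem pointColor_inj {q d x y a b : ℕ} (hq : 0 < q) {s s' : NodeState}
    (h : pointColor q d x a s = pointColor q d y b s') :
    x = y ∧ (digitPoly q d s.col x + a) % q = (digitPoly q d s'.col y + b) % q :=
  mul_add_inj (Nat.mod_lt _ hq) (Nat.mod_lt _ hq) h

/-- Some shift of the polynomial contains few of the given colors. -/
theorem exists_shift {q d Q : ℕ} (s : NodeState) (T : Finset ℕ)
    (hT : T.card < q * (Q + 1)) :
    ∃ a < q, ((Finset.range q).filter fun x => pointColor q d x a s + 1 ∈ T).card ≤ Q := by
  by_contra! hcon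
  have hq : 0 < q := Nat.pos_of_ne_zero (by rintro rfl; simp at hT)
  -- The graphs of the `q` shifts are disjoint, because a point and its value determine the shift.
  -- Each color of `T` is therefore counted at most once.
  have hle : ((Finset.range q).sigma fun a =>
      (Finset.range q).filter fun x => pointColor q d x a s + 1 ∈ T).card ≤ T.card := by
    refine Finset.card_le_card_of_injOn (fun p => pointColor q d p.2 p.1 s + 1) ?_ ?_
    · intro p hp
      exact (Finset.mem_filter.1 (Finset.mem_sigma.1 hp).2).2
    · rintro ⟨a, x⟩ hp ⟨a', x'⟩ hp' h
      have ha := Finset.mem_range.1 (Finset.mem_sigma.1 hp).1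
      have ha' := Finset.mem_range.1 (Finset.mem_sigma.1 hp').1
      obtain ⟨hx, hy⟩ := pointColor_inj hq (Nat.succ_injective h)
      dsimp only at hx hy ha ha'
      subst hx
      have := Nat.ModEq.add_left_cancel' (n := q) _ hy
      rw [Nat.ModEq, Nat.mod_eq_of_lt ha, Nat.mod_eq_of_lt ha'] at this
      rw [this]
  rw [Finset.card_sigma] at hle
  have := Finset.card_nsmul_le_sum (Finset.range q) (fun a =>
      ((Finset.range q).filter fun x => pointColor q d x a s + 1 ∈ T).card) (Q + 1)
    fun a ha => hcon a (Finset.mem_range.1 ha)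
  rw [Finset.card_range, smul_eq_mul] at this
  omega

/-- The nodes of the first `j` classes, and only those, are colored properly with colors below
`q ^ 2`, and all data but the shifts are those of the states `s₀`. -/
structure ListColored (G : SimpleGraph V) (q j : ℕ) (s₀ s : V → NodeState) : Prop where
  col_eq : ∀ v, (s v).col = (s₀ v).col
  cls_eq : ∀ v, (s v).cls = (s₀ v).cls
  time_eq : ∀ v, (s v).time = (s₀ v).time
  lvl_eq : ∀ v, (s v).lvl = (s₀ v).lvl
  fin_ne_zero : ∀ v, (s v).fin ≠ 0 ↔ (s₀ v).cls ≤ j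
  fin_le : ∀ v, (s v).fin ≤ q ^ 2
  proper : ∀ u v, G.Adj u v → (s u).fin ≠ 0 → (s u).fin ≠ (s v).fin

/-- The `q` shifts of a polynomial have disjoint graphs, so one of them meets at most `Q` of the at
most `Q * Q` neighbor colors. At most `β` out-neighbors in the same class block at most `d` further
points each. In total at most `Q + β * d ≤ (d + 1) * Q < q` points are blocked. Two rounds are
needed because the shifts of the out-neighbors must be known before a point is picked. -/
theorem ListColored.succ {q q₁ d β Q Δ j : ℕ} {s₀ s : V → NodeState} (hq : q.Prime)
    (hs₀ : ProperBelow G (q ^ d) s₀) (hcls : HasClasses G q₁ β s₀) (hΔ : ∀ v, G.degree v ≤ Δ)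
    (hβ : β ≤ Q) (hΔQ : Δ ≤ Q * Q) (hQ : (d + 1) * Q < q) (hs : ListColored G q j s₀ s) :
    ListColored G q (j + 1) s₀
      (execRounds G [shiftRound q d Q j, pickRound q d j] s) := by
  set s₁ := (shiftRound q d Q j).step G s with hs₁
  set s₂ := (pickRound q d j).step G s₁ with hs₂
  change ListColored G q (j + 1) s₀ s₂
  have h1 : ∀ v, (s₁ v).col = (s v).col ∧ (s₁ v).cls = (s v).cls ∧ (s₁ v).time = (s v).time ∧
      (s₁ v).lvl = (s v).lvl ∧ (s₁ v).fin = (s v).fin := by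
    intro v
    rw [hs₁, Round.step, shiftRound]
    split_ifs <;> exact ⟨rfl, rfl, rfl, rfl, rfl⟩
  have h2 : ∀ v, (s₂ v).col = (s₁ v).col ∧ (s₂ v).cls = (s₁ v).cls ∧
      (s₂ v).time = (s₁ v).time ∧ (s₂ v).lvl = (s₁ v).lvl := by
    intro v
    rw [hs₂, Round.step, pickRound]
    split_ifs <;> exact ⟨rfl, rfl, rfl, rfl⟩
  have hold : ∀ v, (s₀ v).cls ≠ j + 1 → (s₂ v).fin = (s v).fin := by
    intro v hv
    rw [hs₂, Round.step, pickRound, if_neg, (h1 v).2.2.2.2]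
    rw [(h1 v).2.1, hs.cls_eq]
    exact hv
  have hshift : ∀ v, (s₀ v).cls = j + 1 → ((Finset.range q).filter fun x =>
      pointColor q d x (s₁ v).shift (s v) + 1 ∈ (G.neighborFinset v).image fun u => (s u).fin).card
        ≤ Q := by
    intro v hv
    let A := {a | a < q ∧ ((Finset.range q).filter fun x => pointColor q d x a (s v) + 1 ∈
      ((G.neighborFinset v).val.map s).map NodeState.fin).card ≤ Q}
    have hsh : (s₁ v).shift = sInf A := by
      rw [hs₁, Round.step, shiftRound, if_pos]
      rw [hs.cls_eq]
      exact hv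
    have hmem : sInf A ∈ A := by
      apply Nat.sInf_mem
      obtain ⟨a, ha, hc⟩ := exists_shift (q := q) (d := d) (Q := Q) (s v)
        ((G.neighborFinset v).image fun u => (s u).fin) (by
          refine lt_of_le_of_lt (Finset.card_image_le.trans
            ((G.card_neighborFinset_eq_degree v).trans_le ((hΔ v).trans hΔQ))) ?_
          have : Q < q := lt_of_le_of_lt (Nat.le_mul_of_pos_left Q d.succ_pos) hQ
          nlinarith)
      refine ⟨a, ha, le_trans (Finset.card_le_card fun x hx => ?_) hc⟩
      simpa using hx
    rw [hsh]
    refine le_trans (Finset.card_le_card fun x hx => ?_) hmem.2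
    simpa using hx
  have hnew : ∀ v, (s₀ v).cls = j + 1 → ∃ x < q,
      (s₂ v).fin = pointColor q d x (s₁ v).shift (s₁ v) + 1 ∧
      (∀ u, G.Adj v u → (s₁ u).fin ≠ pointColor q d x (s₁ v).shift (s₁ v) + 1) ∧
      ∀ u, G.Adj v u → (s₁ u).cls = (s₁ v).cls → (s₁ u).time ≤ (s₁ v).time →
        pointColor q d x (s₁ u).shift (s₁ u) ≠ pointColor q d x (s₁ v).shift (s₁ v) := by
    intro v hv
    let X := {x | x < q ∧ pointColor q d x (s₁ v).shift (s₁ v) + 1 ∉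
        ((G.neighborFinset v).val.map s₁).map NodeState.fin ∧
      ∀ u ∈ (G.neighborFinset v).val.map s₁, u.cls = (s₁ v).cls → u.time ≤ (s₁ v).time →
        pointColor q d x u.shift u ≠ pointColor q d x (s₁ v).shift (s₁ v)}
    have hfin : (s₂ v).fin = pointColor q d (sInf X) (s₁ v).shift (s₁ v) + 1 := by
      rw [hs₂, Round.step, pickRound, if_pos]
      rw [(h1 v).2.1, hs.cls_eq]
      exact hv
    have hmem : sInf X ∈ X := by
      apply Nat.sInf_mem
      have hb1 := hshift v hv
      have hb2 : (((G.neighborFinset v).filter fun u =>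
          (s₀ u).cls = (s₀ v).cls ∧ (s₀ u).time ≤ (s₀ v).time).biUnion fun u =>
          (Finset.range q).filter fun x => (digitPoly q d (s₀ u).col x + (s₁ u).shift) % q =
            (digitPoly q d (s₀ v).col x + (s₁ v).shift) % q).card ≤ β * d := by
        refine (Finset.card_biUnion_le_card_mul _ _ d fun u hu => ?_).trans
          (Nat.mul_le_mul_right d (hcls.2 v))
        rw [Finset.mem_filter, G.mem_neighborFinset] at hu
        exact card_filter_digitPoly_add_eq_le hq (hs₀.1 u) (hs₀.1 v) (hs₀.2 u v hu.1.symm) _ _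
      have hlt := lt_of_le_of_lt ((Finset.card_union_le _ _).trans (add_le_add hb1 hb2))
        (lt_of_le_of_lt (by nlinarith) hQ)
      obtain ⟨x, hx, hxn⟩ := exists_lt_notMem_of_card_lt hlt
      rw [Finset.mem_union, not_or] at hxn
      refine ⟨x, hx, fun h => hxn.1 ?_, fun w hw hc ht h => hxn.2 ?_⟩
      · rw [Multiset.map_map, mem_neighborFinset_map] at h
        obtain ⟨u, hu, h⟩ := h
        rw [Finset.mem_filter, Finset.mem_image]
        refine ⟨Finset.mem_range.2 hx, u, (G.mem_neighborFinset v u).2 hu, ?_⟩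
        rw [Function.comp_apply, (h1 u).2.2.2.2] at h
        rw [h, pointColor, pointColor, (h1 v).1]
      · obtain ⟨u, hu, rfl⟩ := (mem_neighborFinset_map G).1 hw
        rw [(h1 u).2.1, (h1 v).2.1, hs.cls_eq, hs.cls_eq] at hc
        rw [(h1 u).2.2.1, (h1 v).2.2.1, hs.time_eq, hs.time_eq] at ht
        have h' := (pointColor_inj hq.pos h).2
        rw [(h1 u).1, (h1 v).1, hs.col_eq, hs.col_eq] at h'
        exact Finset.mem_biUnion.2 ⟨u, Finset.mem_filter.2
          ⟨(G.mem_neighborFinset v u).2 hu, hc, ht⟩,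
          Finset.mem_filter.2 ⟨Finset.mem_range.2 hx, h'⟩⟩
    refine ⟨sInf X, hmem.1, hfin, fun u hu h => hmem.2.1 ?_, fun u hu =>
      hmem.2.2 _ ((mem_neighborFinset_map G).2 ⟨u, hu, rfl⟩)⟩
    rw [Multiset.map_map, mem_neighborFinset_map]
    exact ⟨u, hu, h⟩
  have hpos : ∀ v, (s₂ v).fin ≠ 0 ↔ (s₀ v).cls ≤ j + 1 := by
    intro v
    by_cases hv : (s₀ v).cls = j + 1
    · obtain ⟨x, -, hx, -⟩ := hnew v hv
      simp [hx, hv]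
    · rw [hold v hv, hs.fin_ne_zero]
      omega
  have hmixed : ∀ u v, G.Adj u v → (s₀ u).cls ≠ j + 1 → (s₀ v).cls = j + 1 →
      (s₂ u).fin ≠ (s₂ v).fin := by
    intro u v huv hu hv
    obtain ⟨x, -, hx, hx', -⟩ := hnew v hv
    rw [hold u hu, hx, ← (h1 u).2.2.2.2]
    exact hx' u huv.symm
  -- Both nodes pick simultaneously, yet `v` avoids the whole shifted polynomial of its out-neighbor
  -- `u`, hence whatever point `u` picks on it.
  have hboth : ∀ u v, G.Adj u v → (s₀ u).cls = j + 1 → (s₀ v).cls = j + 1 →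
      (s₀ u).time ≤ (s₀ v).time → (s₂ u).fin ≠ (s₂ v).fin := by
    intro u v huv hu hv ht h
    obtain ⟨x, -, hx, -⟩ := hnew u hu
    obtain ⟨y, -, hy, -, hy'⟩ := hnew v hv
    rw [hx, hy] at h
    have h := Nat.succ_injective h
    obtain ⟨rfl, -⟩ := pointColor_inj hq.pos h
    refine hy' u huv.symm ?_ ?_ h
    · rw [(h1 u).2.1, (h1 v).2.1, hs.cls_eq, hs.cls_eq, hu, hv]
    · rwa [(h1 u).2.2.1, (h1 v).2.2.1, hs.time_eq, hs.time_eq]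
  refine ⟨fun v => ?_, fun v => ?_, fun v => ?_, fun v => ?_, hpos, fun v => ?_,
    fun u v huv hu => ?_⟩
  · rw [(h2 v).1, (h1 v).1, hs.col_eq]
  · rw [(h2 v).2.1, (h1 v).2.1, hs.cls_eq]
  · rw [(h2 v).2.2.1, (h1 v).2.2.1, hs.time_eq]
  · rw [(h2 v).2.2.2, (h1 v).2.2.2.1, hs.lvl_eq]
  · by_cases hv : (s₀ v).cls = j + 1
    · obtain ⟨x, hx, hx', -⟩ := hnew v hv
      rw [hx']
      exact mul_add_lt_sq hx (Nat.mod_lt _ hq.pos)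
    · rw [hold v hv]
      exact hs.fin_le v
  · by_cases hu' : (s₀ u).cls = j + 1 <;> by_cases hv' : (s₀ v).cls = j + 1
    · rcases le_total (s₀ u).time (s₀ v).time with ht | ht
      · exact hboth u v huv hu' hv' ht
      · exact (hboth v u huv.symm hv' hu' ht).symm
    · exact (hmixed v u huv.symm hv' hu').symm
    · exact hmixed u v huv hu' hv'
    · rw [hold u hu', hold v hv']
      exact hs.proper u v huv (by rwa [← hold u hu'])

/-- Coloring the classes one after the other. -/
noncomputable def listRounds (q₁ q d Q : ℕ) : List Round :=
  (List.range q₁).flatMap (fun j => [shiftRound q d Q j, pickRound q d j]) ++ [adoptRound]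

theorem properBelow_listRounds {q q₁ d β Q Δ : ℕ} {s : V → NodeState} (hq : q.Prime)
    (hs : ProperBelow G (q ^ d) s) (hcls : HasClasses G q₁ β s) (hfin : ∀ v, (s v).fin = 0)
    (hΔ : ∀ v, G.degree v ≤ Δ) (hβ : β ≤ Q) (hΔQ : Δ ≤ Q * Q) (hQ : (d + 1) * Q < q) :
    ProperBelow G (q ^ 2) (execRounds G (listRounds q₁ q d Q) s) ∧
      ∀ v, (execRounds G (listRounds q₁ q d Q) s v).lvl = (s v).lvl := by
  have hind : ∀ j, ListColored G q j s (execRounds G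
      ((List.range j).flatMap (fun j => [shiftRound q d Q j, pickRound q d j])) s) := by
    intro j
    induction j with
    | zero =>
      refine ⟨fun _ => rfl, fun _ => rfl, fun _ => rfl, fun _ => rfl, fun v => ?_, fun v => ?_,
        fun u v _ hu => absurd (hfin u) hu⟩
      · have := (hcls.1 v).1
        simp [execRounds, hfin v, this]
      · simp [execRounds, hfin v]
    | succ j ih =>
      rw [execRounds_flatMap_range_succ]
      exact ih.succ hq hs hcls hΔ hβ hΔQ hQ
  rw [listRounds, execRounds_append]
  have h := hind q₁
  set s' := execRounds G
    ((List.range q₁).flatMap (fun j => [shiftRound q d Q j, pickRound q d j])) s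
  have hne : ∀ v, (s' v).fin ≠ 0 := fun v => (h.fin_ne_zero v).2 (hcls.1 v).2
  refine ⟨⟨fun v => ?_, fun u v huv he => h.proper u v huv (hne u) ?_⟩, h.lvl_eq⟩
  · change (s' v).fin - 1 < q ^ 2
    have := hne v
    have := h.fin_le v
    omega
  · change (s' u).fin - 1 = (s' v).fin - 1 at he
    have := hne u
    have := hne v
    omega

end ListColoring

/-! ### Sparsification digit by digit -/

section Ruling

variable {V : Type*} {G : SimpleGraph V} [G.LocallyFinite]

/-- One sparsification phase: the digit number `i` of the colors in base `b` is used. -/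
def phaseRounds (b i : ℕ) : List Round := (List.range b).map (levelRound b i)

/-- The invariant of the sparsification: after `i` phases, adjacent nodes that have survived agree
in the first `i` digits, and every node has a surviving node in distance at most `i`. -/
structure Sparsified (G : SimpleGraph V) (b i : ℕ) (s : V → NodeState) : Prop where
  lvl_le : ∀ v, (s v).lvl ≤ i
  digits : ∀ u v, G.Adj u v → (s u).lvl = i → (s v).lvl = i →
    (s u).col % b ^ i = (s v).col % b ^ i
  dominated : ∀ v, ∃ w, (s w).lvl = i ∧ G.edist v w ≤ i

/-- Adjacent nodes can survive the phase only in the same round `j`, that is, with the same digit. A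
node that fails in its round already has a surviving neighbor, so the distance to the survivors
grows by at most one. -/
theorem Sparsified.succ {b i : ℕ} (hb : 0 < b) {s : V → NodeState} (hs : Sparsified G b i s) :
    Sparsified G b (i + 1) (execRounds G (phaseRounds b i) s) ∧
      ∀ v, (execRounds G (phaseRounds b i) s v).col = (s v).col := by
  set S : ℕ → V → NodeState := fun j => execRounds G ((List.range j).map (levelRound b i)) s
    with hSdef
  have hS : ∀ j v, S (j + 1) v = levelRound b i j (S j v) ((G.neighborFinset v).val.map (S j)) :=
    fun j v => by
      rw [hSdef]
      simp only
      rw [execRounds_map_range_succ]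
      rfl
  have hcol : ∀ j v, (S j v).col = (s v).col := by
    intro j v
    induction j with
    | zero => rfl
    | succ j ih =>
      rw [hS, levelRound]
      split_ifs <;> exact ih
  -- After the rounds below `j`, only nodes with digit below `j` have moved up, neighbors that moved
  -- up share the digit, and every candidate with digit below `j` has moved up or has a neighbor
  -- that did.
  have hinv : ∀ j, (∀ v, (S j v).lvl = (s v).lvl ∨ ((s v).lvl = i ∧ (S j v).lvl = i + 1)) ∧
      (∀ v, (S j v).lvl = i + 1 → (s v).col / b ^ i % b < j) ∧
      (∀ u v, G.Adj u v → (S j u).lvl = i + 1 → (S j v).lvl = i + 1 →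
        (s u).col / b ^ i % b = (s v).col / b ^ i % b) ∧
      ∀ v, (s v).lvl = i → (s v).col / b ^ i % b < j →
        (S j v).lvl = i + 1 ∨ ∃ w, G.Adj v w ∧ (S j w).lvl = i + 1 := by
    intro j
    induction j with
    | zero =>
      have h0 : ∀ v, (S 0 v).lvl ≠ i + 1 := fun v h => by
        have : (s v).lvl = i + 1 := h
        have := hs.lvl_le v
        omega
      exact ⟨fun v => Or.inl rfl, fun v h => absurd h (h0 v), fun u v _ h => absurd h (h0 u),
        fun v _ h => absurd h (Nat.not_lt_zero _)⟩
    | succ j ih =>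
      obtain ⟨ih1, ih2, ih3, ih4⟩ := ih
      have hcase : ∀ v, ((S j v).lvl = i ∧ (s v).col / b ^ i % b = j ∧
          (∀ w, G.Adj v w → (S j w).lvl ≠ i + 1) ∧ (S (j + 1) v).lvl = i + 1) ∨
          (¬ ((S j v).lvl = i ∧ (s v).col / b ^ i % b = j ∧
          (∀ w, G.Adj v w → (S j w).lvl ≠ i + 1)) ∧ (S (j + 1) v).lvl = (S j v).lvl) := by
        intro v
        rw [hS, levelRound]
        split_ifs with h <;> rw [Multiset.map_map, mem_neighborFinset_map, hcol] at h
        · exact Or.inl ⟨h.1, h.2.1, fun w hw hl => h.2.2 ⟨w, hw, hl⟩, rfl⟩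
        · exact Or.inr ⟨fun h' => h ⟨h'.1, h'.2.1, fun ⟨w, hw, hl⟩ => h'.2.2 w hw hl⟩, rfl⟩
      have hmono : ∀ v, (S j v).lvl = i + 1 → (S (j + 1) v).lvl = i + 1 := by
        intro v hv
        rcases hcase v with h | h
        · exact h.2.2.2
        · rw [h.2, hv]
      refine ⟨fun v => ?_, fun v hv => ?_, fun u v huv hu hv => ?_, fun v hv hd => ?_⟩
      · rcases hcase v with h | h
        · rcases ih1 v with h' | h'
          · exact Or.inr ⟨h'.symm.trans h.1, h.2.2.2⟩
          · exact Or.inr ⟨h'.1, h.2.2.2⟩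
        · rw [h.2]
          exact ih1 v
      · rcases hcase v with h | h
        · omega
        · have := ih2 v (h.2.symm.trans hv)
          omega
      · rcases hcase u with h | h <;> rcases hcase v with h' | h'
        · rw [h.2.1, h'.2.1]
        · exact absurd (h'.2.symm.trans hv) (h.2.2.1 v huv)
        · exact absurd (h.2.symm.trans hu) (h'.2.2.1 u huv.symm)
        · exact ih3 u v huv (h.2.symm.trans hu) (h'.2.symm.trans hv)
      · rcases Nat.lt_succ_iff_lt_or_eq.1 hd with hlt | heq
        · rcases ih4 v hv hlt with h | ⟨w, hw, h⟩
          · exact Or.inl (hmono v h)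
          · exact Or.inr ⟨w, hw, hmono w h⟩
        · rcases hcase v with h | h
          · exact Or.inl h.2.2.2
          · rcases ih1 v with h1 | h1
            · have : ¬ ∀ w, G.Adj v w → (S j w).lvl ≠ i + 1 := fun hall =>
                h.1 ⟨h1.trans hv, heq, hall⟩
              push Not at this
              obtain ⟨w, hw, hl⟩ := this
              exact Or.inr ⟨w, hw, hmono w hl⟩
            · exact Or.inl (hmono v h1.2)
  obtain ⟨h1, -, h3, h4⟩ := hinv b
  refine ⟨⟨fun v => ?_, fun u v huv hu hv => ?_, fun v => ?_⟩, hcol b⟩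
  · change (S b v).lvl ≤ i + 1
    have := hs.lvl_le v
    rcases h1 v with h | h <;> omega
  · change (S b u).lvl = i + 1 at hu
    change (S b v).lvl = i + 1 at hv
    change (S b u).col % b ^ (i + 1) = (S b v).col % b ^ (i + 1)
    have hlow : ∀ v, (S b v).lvl = i + 1 → (s v).lvl = i := fun v hv => by
      have := hs.lvl_le v
      rcases h1 v with h | h <;> omega
    rw [hcol, hcol, Nat.mod_pow_succ, Nat.mod_pow_succ, hs.digits u v huv (hlow u hu) (hlow v hv),
      h3 u v huv hu hv]
  · obtain ⟨w, hw, hd⟩ := hs.dominated v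
    rcases h4 w hw (Nat.mod_lt _ hb) with h | ⟨w', hw', h⟩
    · exact ⟨w, h, hd.trans (by exact_mod_cast Nat.le_succ i)⟩
    · refine ⟨w', h, (SimpleGraph.edist_triangle (v := w)).trans ?_⟩
      push_cast
      exact add_le_add hd (SimpleGraph.edist_eq_one_iff_adj.2 hw').le

/-- All sparsification phases. -/
def rulingRounds (b r : ℕ) : List Round := (List.range r).flatMap (phaseRounds b)

theorem isTwoRulingSet_rulingRounds {b r : ℕ} (hb : 0 < b) {s : V → NodeState}
    (hs : ProperBelow G (b ^ r) s) (hlvl : ∀ v, (s v).lvl = 0) :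
    IsTwoRulingSet G r {v | r ≤ (execRounds G (rulingRounds b r) s v).lvl} := by
  have hind : ∀ i, Sparsified G b i (execRounds G ((List.range i).flatMap (phaseRounds b)) s) ∧
      ∀ v, (execRounds G ((List.range i).flatMap (phaseRounds b)) s v).col = (s v).col := by
    intro i
    induction i with
    | zero =>
      refine ⟨⟨fun v => (hlvl v).le, fun u v _ _ _ => by simp [Nat.mod_one], fun v =>
        ⟨v, hlvl v, by simp⟩⟩, fun v => rfl⟩
    | succ i ih =>
      rw [execRounds_flatMap_range_succ]
      obtain ⟨h1, h2⟩ := ih.1.succ hb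
      exact ⟨h1, fun v => (h2 v).trans (ih.2 v)⟩
  obtain ⟨h, hcol⟩ := hind r
  refine ⟨fun u hu v hv _ huv => ?_, fun v => ?_⟩
  · have he := h.digits u v huv (le_antisymm (h.lvl_le u) hu) (le_antisymm (h.lvl_le v) hv)
    rw [hcol, hcol, Nat.mod_eq_of_lt (hs.1 u), Nat.mod_eq_of_lt (hs.1 v)] at he
    exact hs.2 u v huv he
  · obtain ⟨w, hw, hd⟩ := h.dominated v
    exact ⟨w, hw.ge, hd⟩

end Ruling

/-! ### The number of color reduction rounds -/

theorem logb_two_le_sub_one {x : ℝ} (hx : 2 ≤ x) : Real.logb 2 x ≤ x - 1 := by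
  rw [Real.logb_le_iff_le_rpow (by norm_num) (by linarith)]
  have h := one_add_mul_self_le_rpow_one_add (s := 1) (by norm_num) (p := x - 1) (by linarith)
  norm_num at h
  linarith

theorem logb_two_le_self {x : ℝ} (hx : 1 ≤ x) : Real.logb 2 x ≤ x := by
  rw [Real.logb_le_iff_le_rpow (by norm_num) (by linarith)]
  have h := one_add_mul_self_le_rpow_one_add (s := 1) (by norm_num) (p := x) hx
  norm_num at h
  linarith

/-- Above `2` the logarithm lowers its argument by at least `1`, so `logStar` is the infimum of a
nonempty set. -/
theorem exists_iterate_logb_le_one (N : ℕ) :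
    ∀ x : ℝ, x ≤ N + 1 → ∃ k : ℕ, (Real.logb 2)^[k] x ≤ 1 := by
  induction N with
  | zero => exact fun x hx => ⟨0, by simpa using hx⟩
  | succ N ih =>
    intro x hx
    push_cast at hx
    rcases le_or_gt x 1 with h1 | h1
    · exact ⟨0, h1⟩
    rcases le_or_gt x 2 with h2 | h2
    · refine ⟨1, ?_⟩
      rw [Function.iterate_one, Real.logb_le_iff_le_rpow (by norm_num) (by linarith)]
      simpa using h2
    · obtain ⟨k, hk⟩ := ih (Real.logb 2 x) (by linarith [logb_two_le_sub_one h2.le])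
      exact ⟨k + 1, by rwa [Function.iterate_succ_apply]⟩

theorem iterate_logb_logStar_le_one (n : ℕ) : (Real.logb 2)^[logStar n] (n : ℝ) ≤ 1 :=
  Nat.sInf_mem (s := {k : ℕ | (Real.logb 2)^[k] (n : ℝ) ≤ 1})
    (exists_iterate_logb_le_one n n (by linarith))

theorem one_lt_iterate_logb {n i : ℕ} (hi : i < logStar n) : 1 < (Real.logb 2)^[i] (n : ℝ) :=
  not_le.1 (Nat.notMem_of_lt_sInf hi)

theorem iterate_logb_le {n : ℕ} (i : ℕ) (hi : i < logStar n) :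
    (Real.logb 2)^[i] (n : ℝ) ≤ n := by
  induction i with
  | zero => exact le_rfl
  | succ i ih =>
    rw [Function.iterate_succ_apply']
    exact (logb_two_le_self (one_lt_iterate_logb (by omega : i < logStar n)).le).trans
      (ih (by omega))

/-- The prime used for the color reduction from `m` colors. -/
noncomputable def linialPrime (Δ m : ℕ) : ℕ := primeAbove (Nat.clog 2 m * Δ)

/-- The number of colors after one round of color reduction. -/
noncomputable def linialNext (Δ m : ℕ) : ℕ := linialPrime Δ m ^ 2

/-- The factor in the number of colors at which the color reduction stops. -/
def thresholdFactor (κ : ℕ) : ℕ := 2 ^ (κ + 3) * (256 * (κ + 4) ^ 8)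

theorem linialNext_le {Δ m : ℕ} (hΔ : 1 ≤ Δ) (hm : 2 ≤ m) :
    linialNext Δ m ≤ (2 * (Nat.clog 2 m * Δ)) ^ 2 :=
  Nat.pow_le_pow_left (primeAbove_le
    (Nat.mul_ne_zero (Nat.clog_pos (by norm_num) hm).ne' (by omega))) 2

theorem clog_two_le {m : ℕ} (hm : 2 ≤ m) : (Nat.clog 2 m : ℝ) ≤ Real.logb 2 m + 1 := by
  have h1 := Nat.pow_pred_clog_lt_self (b := 2) (by norm_num) (x := m) hm
  have h2 : (2 : ℝ) ^ (Nat.clog 2 m).pred ≤ m := by exact_mod_cast h1.le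
  have h3 := Real.logb_le_logb_of_le (b := 2) (by norm_num) (by positivity) h2
  rw [Real.logb_pow, Real.logb_self_eq_one (by norm_num), mul_one] at h3
  have h4 : Nat.clog 2 m = (Nat.clog 2 m).pred + 1 :=
    (Nat.succ_pred_eq_of_pos (Nat.clog_pos (by norm_num) hm)).symm
  rw [h4]
  push_cast
  linarith

/-- As long as the number of colors is above the threshold, one color reduction round decreases it
as fast as taking the logarithm. -/
theorem linialNext_le_pow {κ Δ m : ℕ} {y : ℝ} (hΔ : 1 ≤ Δ) (hm : 2 ≤ m)
    (hmy : (m : ℝ) ≤ y ^ (κ + 3)) (hlog : 1 < Real.logb 2 y)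
    (hbig : thresholdFactor κ * Δ ^ 8 < linialNext Δ m) :
    (linialNext Δ m : ℝ) ≤ Real.logb 2 y ^ (κ + 3) := by
  set z := Real.logb 2 y
  set x : ℝ := (linialNext Δ m : ℝ) with hx
  -- The `+ 1` from rounding up is absorbed by `1 < z`.
  have hL : (Nat.clog 2 m : ℝ) ≤ (κ + 4) * z := by
    have h1 := clog_two_le hm
    have h2 := Real.logb_le_logb_of_le (b := 2) (by norm_num) (by positivity) hmy
    rw [Real.logb_pow] at h2
    push_cast at h2
    change _ ≤ ((κ : ℝ) + 3) * z at h2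
    linarith
  have hxle : x ≤ (2 * ((κ + 4) * z * Δ)) ^ 2 := by
    have h1 : x ≤ (2 * ((Nat.clog 2 m : ℝ) * Δ)) ^ 2 := by
      rw [hx]
      exact_mod_cast linialNext_le hΔ hm
    refine h1.trans ?_
    gcongr
  have hgt : 256 * ((κ : ℝ) + 4) ^ 8 * (Δ : ℝ) ^ 8 < x := by
    have h1 : (256 * (κ + 4) ^ 8) * Δ ^ 8 < linialNext Δ m := by
      refine lt_of_le_of_lt (Nat.mul_le_mul_right _ ?_) hbig
      exact Nat.le_mul_of_pos_left _ (by positivity)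
    rw [hx]
    exact_mod_cast h1
  have hx0 : 0 < x := lt_of_le_of_lt (by positivity) hgt
  -- Being above the threshold, `x` itself dominates the factor `256 * (κ + 4) ^ 8 * Δ ^ 8`.
  -- Cancelling it leaves `x ^ 3 ≤ z ^ 8`, and `z ^ 8 ≤ z ^ 9` then gives `x ≤ z ^ 3`.
  have h4 : x ^ 4 ≤ x * z ^ 8 := by
    calc x ^ 4 ≤ ((2 * ((κ + 4) * z * Δ)) ^ 2) ^ 4 := by gcongr
      _ = (256 * ((κ : ℝ) + 4) ^ 8 * (Δ : ℝ) ^ 8) * z ^ 8 := by ring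
      _ ≤ x * z ^ 8 := by gcongr
  have h3 : x ^ 3 ≤ (z ^ 3) ^ 3 := by
    have h5 : x ^ 3 ≤ z ^ 8 := by
      refine le_of_mul_le_mul_left ?_ hx0
      calc x * x ^ 3 = x ^ 4 := by ring
        _ ≤ _ := h4
    rw [← pow_mul]
    exact h5.trans (pow_le_pow_right₀ hlog.le (by norm_num))
  have h6 : x ≤ z ^ 3 := le_of_pow_le_pow_left₀ (by norm_num) (by positivity) h3
  exact h6.trans (pow_le_pow_right₀ hlog.le (by omega))

/-- The exponent `κ + 3` stays fixed along the iteration, so each reduction round matches exactly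
one logarithm. This is why `log* n` appears with factor one. -/
theorem iterate_linialNext_le {n κ Δ m : ℕ} (hΔ : 1 ≤ Δ) (hm : m ≤ n ^ κ) (i : ℕ)
    (hi : i < logStar n)
    (hbig : ∀ j ≤ i, thresholdFactor κ * Δ ^ 8 < (linialNext Δ)^[j] m) :
    (((linialNext Δ)^[i] m : ℕ) : ℝ) ≤ (Real.logb 2)^[i] (n : ℝ) ^ (κ + 3) := by
  induction i with
  | zero =>
    have h1 := one_lt_iterate_logb hi
    have h2 : (m : ℝ) ≤ (n : ℝ) ^ κ := by exact_mod_cast hm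
    exact h2.trans (pow_le_pow_right₀ h1.le (by omega))
  | succ i ih =>
    have hih := ih (by omega) fun j hj => hbig j (by omega)
    have h1 := hbig i (by omega)
    have h2 := hbig (i + 1) le_rfl
    have h4 := one_lt_iterate_logb hi
    rw [Function.iterate_succ_apply'] at h2 h4 ⊢
    rw [Function.iterate_succ_apply']
    refine linialNext_le_pow hΔ ?_ hih h4 h2
    have : 0 < thresholdFactor κ * Δ ^ 8 := by unfold thresholdFactor; positivity
    omega

/-- The number of color reduction rounds. -/
noncomputable def linialCount (κ Δ m : ℕ) : ℕ :=
  sInf {k | (linialNext Δ)^[k] m ≤ thresholdFactor κ * Δ ^ 8}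

/-- One step before `logStar n` the iterated logarithm is at most `2`, so at most `2 ^ (κ + 3)`
colors would remain, which `thresholdFactor` covers by design. The last bound serves the message
lengths. -/
theorem linialCount_spec {n κ Δ m : ℕ} (hΔ : 1 ≤ Δ) (hm : m ≤ n ^ κ) :
    linialCount κ Δ m ≤ logStar n ∧
      (linialNext Δ)^[linialCount κ Δ m] m ≤ thresholdFactor κ * Δ ^ 8 ∧
      ∀ i < linialCount κ Δ m, (linialNext Δ)^[i] m ≤ n ^ (κ + 3) := by
  have hex : ∃ k ≤ logStar n, (linialNext Δ)^[k] m ≤ thresholdFactor κ * Δ ^ 8 := by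
    have hstar := iterate_logb_logStar_le_one n
    rcases hs : logStar n with _ | s
    · rw [hs] at hstar
      have hn : n ≤ 1 := by exact_mod_cast (show (n : ℝ) ≤ 1 from hstar)
      refine ⟨0, le_rfl, (hm.trans (Nat.pow_le_pow_left hn κ)).trans ?_⟩
      rw [one_pow, Nat.one_le_iff_ne_zero]
      unfold thresholdFactor
      positivity
    · by_contra! hcon
      have h1 := iterate_linialNext_le hΔ hm s (by omega) fun j hj => hcon j (by omega)
      have h0 := one_lt_iterate_logb (by omega : s < logStar n)
      rw [hs, Function.iterate_succ_apply',
        Real.logb_le_iff_le_rpow (by norm_num) (by linarith), Real.rpow_one] at hstar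
      have h2 : (((linialNext Δ)^[s] m : ℕ) : ℝ) ≤ (2 : ℝ) ^ (κ + 3) :=
        h1.trans (by gcongr)
      have h3 : (linialNext Δ)^[s] m ≤ 2 ^ (κ + 3) := by exact_mod_cast h2
      have h4 := hcon s (by omega)
      have h5 : 2 ^ (κ + 3) ≤ thresholdFactor κ * Δ ^ 8 := by
        unfold thresholdFactor
        rw [mul_assoc]
        exact Nat.le_mul_of_pos_right _ (by positivity)
      omega
  obtain ⟨k, hk, hkm⟩ := hex
  have hle : linialCount κ Δ m ≤ logStar n := (Nat.sInf_le
    (s := {k | (linialNext Δ)^[k] m ≤ thresholdFactor κ * Δ ^ 8}) hkm).trans hk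
  refine ⟨hle, Nat.sInf_mem
    (s := {k | (linialNext Δ)^[k] m ≤ thresholdFactor κ * Δ ^ 8}) ⟨k, hkm⟩, fun i hi => ?_⟩
  have h1 := iterate_linialNext_le hΔ hm i (by omega) fun j hj =>
    not_le.1 (Nat.notMem_of_lt_sInf
      (s := {k | (linialNext Δ)^[k] m ≤ thresholdFactor κ * Δ ^ 8}) (lt_of_le_of_lt hj hi))
  have h2 := iterate_logb_le i (lt_of_lt_of_le hi hle)
  have h3 := one_lt_iterate_logb (lt_of_lt_of_le hi hle)
  have h4 : (((linialNext Δ)^[i] m : ℕ) : ℝ) ≤ (n : ℝ) ^ (κ + 3) :=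
    h1.trans (by gcongr)
  exact_mod_cast h4

/-- The first `k` rounds of color reduction. -/
noncomputable def linialRounds (Δ m k : ℕ) : List Round :=
  (List.range k).map fun i =>
    linialRound (linialPrime Δ ((linialNext Δ)^[i] m)) (Nat.clog 2 ((linialNext Δ)^[i] m))

theorem properBelow_linialRounds {V : Type*} {G : SimpleGraph V} [G.LocallyFinite] {Δ m : ℕ}
    {s : V → NodeState} (hs : ProperBelow G m s) (hf : Fresh s) (hΔ : ∀ v, G.degree v ≤ Δ)
    (k : ℕ) :
    ProperBelow G ((linialNext Δ)^[k] m) (execRounds G (linialRounds Δ m k) s) ∧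
      Fresh (execRounds G (linialRounds Δ m k) s) := by
  induction k with
  | zero => exact ⟨hs, hf⟩
  | succ k ih =>
    rw [linialRounds, execRounds_map_range_succ, Function.iterate_succ_apply']
    refine ⟨?_, ih.2⟩
    set M := (linialNext Δ)^[k] m
    obtain ⟨hp, hlt⟩ := primeAbove_spec (Nat.clog 2 M * Δ)
    refine properBelow_linialRound hp ⟨fun v => (ih.1.1 v).trans_le ?_, ih.1.2⟩ hΔ hlt
    exact (Nat.le_pow_clog (by norm_num) M).trans (Nat.pow_le_pow_left hp.two_le _)

/-! ### Parameters -/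

/-- The least `t` with `Δ ^ 2 ≤ t ^ (r + 2)`, that is `Δ ^ (2 / (r + 2))` rounded up. -/
noncomputable def roundScale (r Δ : ℕ) : ℕ := sInf {t | Δ ^ 2 ≤ t ^ (r + 2)}

/-- The bound for the number of conflicts in the classes. -/
noncomputable def outBound (r Δ : ℕ) : ℕ := Δ / roundScale r Δ + 1

/-- The scale of the prime used for the coloring of the classes. -/
noncomputable def fieldScale (r Δ : ℕ) : ℕ := max (outBound r Δ) (roundScale r Δ)

/-- The number of free coefficients of the polynomials. -/
def polyDegree (r κ : ℕ) : ℕ := thresholdFactor κ + 8 * (r + 2)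

/-- The number of classes. -/
noncomputable def classPrime (r κ Δ : ℕ) : ℕ :=
  primeAbove ((2 * polyDegree r κ + 1) * roundScale r Δ)

/-- The prime used for the coloring of the classes. -/
noncomputable def colorPrime (r κ Δ : ℕ) : ℕ :=
  primeAbove ((polyDegree r κ + 1) * fieldScale r Δ)

/-- The base of the digits in the sparsification phases. -/
noncomputable def digitBase (r κ Δ : ℕ) : ℕ := 16 * (polyDegree r κ + 1) ^ 2 * roundScale r Δ

section Parameters

variable {r κ Δ : ℕ}

theorem sq_le_roundScale_pow (hΔ : 1 ≤ Δ) : Δ ^ 2 ≤ roundScale r Δ ^ (r + 2) :=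
  Nat.sInf_mem (s := {t | Δ ^ 2 ≤ t ^ (r + 2)})
    ⟨Δ, show Δ ^ 2 ≤ Δ ^ (r + 2) from Nat.pow_le_pow_right hΔ (by omega)⟩

theorem roundScale_pos (hΔ : 1 ≤ Δ) : 0 < roundScale r Δ := by
  refine Nat.pos_of_ne_zero fun h => ?_
  have := sq_le_roundScale_pow (r := r) hΔ
  rw [h, zero_pow (by omega)] at this
  have : 0 < Δ ^ 2 := by positivity
  omega

theorem roundScale_le (hΔ : 1 ≤ Δ) :
    (roundScale r Δ : ℝ) ≤ 2 * (Δ : ℝ) ^ (2 / ((r : ℝ) + 2)) := by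
  set X : ℝ := (Δ : ℝ) ^ (2 / ((r : ℝ) + 2)) with hX
  have hΔ' : (1 : ℝ) ≤ Δ := by exact_mod_cast hΔ
  have hX1 : 1 ≤ X := Real.one_le_rpow hΔ' (by positivity)
  have hpow : X ^ (r + 2) = (Δ : ℝ) ^ 2 := by
    rw [hX, ← Real.rpow_natCast, ← Real.rpow_mul (by positivity), ← Real.rpow_natCast]
    congr 1
    push_cast
    field_simp
  have hmem : Δ ^ 2 ≤ ⌈X⌉₊ ^ (r + 2) := by
    have : (Δ : ℝ) ^ 2 ≤ (⌈X⌉₊ : ℝ) ^ (r + 2) := by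
      rw [← hpow]
      gcongr
      exact Nat.le_ceil X
    exact_mod_cast this
  have h1 : roundScale r Δ ≤ ⌈X⌉₊ := Nat.sInf_le (s := {t | Δ ^ 2 ≤ t ^ (r + 2)}) hmem
  have h2 : (roundScale r Δ : ℝ) ≤ ⌈X⌉₊ := by exact_mod_cast h1
  have h3 := Nat.ceil_lt_add_one (by linarith : 0 ≤ X)
  linarith

theorem le_outBound_mul (hΔ : 1 ≤ Δ) : Δ ≤ outBound r Δ * roundScale r Δ := by
  rw [mul_comm]
  exact (Nat.lt_mul_div_succ Δ (roundScale_pos hΔ)).le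

theorem le_fieldScale_mul_self (hΔ : 1 ≤ Δ) : Δ ≤ fieldScale r Δ * fieldScale r Δ :=
  (le_outBound_mul hΔ).trans (Nat.mul_le_mul (le_max_left _ _) (le_max_right _ _))

/-- This is where the exponent `2 / (r + 2)` comes from: `Δ ^ 2 ≤ t ^ (r + 2)` means `(Δ / t) ^ 2 ≤
t ^ r`, and `t ^ 2 ≤ t ^ r` needs `r ≥ 2`. -/
theorem fieldScale_sq_le (hr : 2 ≤ r) (hΔ : 1 ≤ Δ) :
    fieldScale r Δ ^ 2 ≤ 4 * roundScale r Δ ^ r := by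
  have ht := roundScale_pos (r := r) hΔ
  have hpow : 1 ≤ roundScale r Δ ^ r := Nat.one_le_pow _ _ ht
  rcases max_choice (outBound r Δ) (roundScale r Δ) with h | h
  · rw [fieldScale, h, outBound]
    have h1 : (Δ / roundScale r Δ) ^ 2 ≤ roundScale r Δ ^ r := by
      refine Nat.le_of_mul_le_mul_right (c := roundScale r Δ ^ 2) ?_ (by positivity)
      rw [← mul_pow, ← pow_add]
      exact (Nat.pow_le_pow_left (Nat.div_mul_le_self _ _) 2).trans (sq_le_roundScale_pow hΔ)
    zify at h1 hpow ⊢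
    -- The hint gives `(y + 1) ^ 2 ≤ 2 * y ^ 2 + 2` for `y = Δ / t`.
    nlinarith [sq_nonneg ((Δ : ℤ) / (roundScale r Δ : ℤ) - 1)]
  · rw [fieldScale, h]
    have := Nat.pow_le_pow_right ht hr
    omega

/-- The two summands of `polyDegree` pay for the two factors: `2 ^ a` exceeds `a = thresholdFactor
κ`, and `Δ ≤ t ^ (r + 2)`. -/
theorem threshold_le_pow {q : ℕ} (hΔ : 1 ≤ Δ) (hq : 2 * roundScale r Δ ≤ q) :
    thresholdFactor κ * Δ ^ 8 ≤ q ^ polyDegree r κ := by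
  have ht := roundScale_pos (r := r) hΔ
  have h1 : Δ ≤ roundScale r Δ ^ (r + 2) :=
    (Nat.le_self_pow (by norm_num) Δ).trans (sq_le_roundScale_pow hΔ)
  rw [polyDegree, pow_add]
  refine Nat.mul_le_mul ?_ ?_
  · exact Nat.lt_two_pow_self.le.trans (Nat.pow_le_pow_left (by omega) _)
  · refine (Nat.pow_le_pow_left h1 8).trans ?_
    rw [← pow_mul, mul_comm (r + 2)]
    exact Nat.pow_le_pow_left (by omega) _

theorem polyDegree_pos : 1 ≤ polyDegree r κ := by unfold polyDegree; omega

theorem two_mul_le_classPrime : 2 * roundScale r Δ ≤ classPrime r κ Δ := by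
  refine le_trans (Nat.mul_le_mul_right _ ?_) (primeAbove_spec _).2.le
  have := polyDegree_pos (r := r) (κ := κ)
  omega

theorem two_mul_le_colorPrime : 2 * roundScale r Δ ≤ colorPrime r κ Δ := by
  refine le_trans (Nat.mul_le_mul ?_ (le_max_right _ _)) (primeAbove_spec _).2.le
  have := polyDegree_pos (r := r) (κ := κ)
  omega

theorem classPrime_le (hΔ : 1 ≤ Δ) :
    classPrime r κ Δ ≤ 2 * ((2 * polyDegree r κ + 1) * roundScale r Δ) :=
  primeAbove_le (Nat.mul_ne_zero (by omega) (roundScale_pos hΔ).ne')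

theorem colorPrime_sq_le (hr : 2 ≤ r) (hΔ : 1 ≤ Δ) :
    colorPrime r κ Δ ^ 2 ≤ digitBase r κ Δ ^ r := by
  have h0 : (polyDegree r κ + 1) * fieldScale r Δ ≠ 0 :=
    Nat.mul_ne_zero (by omega) (Nat.pos_of_ne_zero
      (by rw [fieldScale, outBound]; positivity)).ne'
  calc colorPrime r κ Δ ^ 2 ≤ (2 * ((polyDegree r κ + 1) * fieldScale r Δ)) ^ 2 :=
        Nat.pow_le_pow_left (primeAbove_le h0) 2
    _ = 4 * (polyDegree r κ + 1) ^ 2 * fieldScale r Δ ^ 2 := by ring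
    _ ≤ 4 * (polyDegree r κ + 1) ^ 2 * (4 * roundScale r Δ ^ r) :=
        Nat.mul_le_mul_left _ (fieldScale_sq_le hr hΔ)
    _ = 16 * (polyDegree r κ + 1) ^ 2 * roundScale r Δ ^ r := by ring
    _ ≤ (16 * (polyDegree r κ + 1) ^ 2) ^ r * roundScale r Δ ^ r :=
        Nat.mul_le_mul_right _ (Nat.le_self_pow (by omega) _)
    _ = digitBase r κ Δ ^ r := by rw [digitBase, ← mul_pow]

theorem le_digitBase_pow (hr : 2 ≤ r) (hΔ : 1 ≤ Δ) : Δ ≤ digitBase r κ Δ ^ r := by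
  refine (le_fieldScale_mul_self (r := r) hΔ).trans (le_trans ?_ (colorPrime_sq_le hr hΔ))
  rw [sq]
  have : fieldScale r Δ ≤ colorPrime r κ Δ :=
    (Nat.le_mul_of_pos_left _ (Nat.succ_pos _)).trans (primeAbove_spec _).2.le
  exact Nat.mul_le_mul this this

theorem digitBase_pos (hΔ : 1 ≤ Δ) : 0 < digitBase r κ Δ := by
  have := roundScale_pos (r := r) hΔ
  unfold digitBase
  positivity

theorem roundScale_le_digitBase_pow (hr : 2 ≤ r) : roundScale r Δ ≤ digitBase r κ Δ ^ r :=
  (Nat.le_mul_of_pos_left _ (by positivity)).trans (Nat.le_self_pow (by omega) _)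

end Parameters

/-! ### The algorithm -/

/-- The rounds that compute a proper coloring with `colorPrime r κ Δ ^ 2` colors. -/
noncomputable def coloringRounds (r κ m Δ : ℕ) : List Round :=
  linialRounds Δ m (linialCount κ Δ m) ++
    ((List.range (classPrime r κ Δ)).map
      (classRound (classPrime r κ Δ) (polyDegree r κ) (outBound r Δ)) ++
    listRounds (classPrime r κ Δ) (colorPrime r κ Δ) (polyDegree r κ) (fieldScale r Δ))

/-- All rounds. The coloring is skipped if there are few input colors. -/
noncomputable def rulingProgram (r κ m Δ : ℕ) : List Round :=
  if Δ = 0 then []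
  else if m ≤ digitBase r κ Δ ^ r then rulingRounds (digitBase r κ Δ) r
  else coloringRounds r κ m Δ ++ rulingRounds (digitBase r κ Δ) r

/-- The initial state. -/
def startState (r Δ c : ℕ) : NodeState where
  col := c
  cls := 0
  time := 0
  shift := 0
  fin := 0
  lvl := if Δ = 0 then r else 0

theorem properBelow_coloringRounds {V : Type*} {G : SimpleGraph V} [G.LocallyFinite]
    {r κ n m Δ : ℕ} (hΔ : 1 ≤ Δ) (hm : m ≤ n ^ κ) (hdeg : ∀ v, G.degree v ≤ Δ)
    {s : V → NodeState} (hs : ProperBelow G m s) (hf : Fresh s) :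
    ProperBelow G (colorPrime r κ Δ ^ 2) (execRounds G (coloringRounds r κ m Δ) s) ∧
      ∀ v, (execRounds G (coloringRounds r κ m Δ) s v).lvl = 0 := by
  rw [coloringRounds, execRounds_append, execRounds_append]
  obtain ⟨hp1, hf1⟩ := properBelow_linialRounds hs hf hdeg (linialCount κ Δ m)
  set s₁ := execRounds G (linialRounds Δ m (linialCount κ Δ m)) s
  have hthr := (linialCount_spec hΔ hm).2.1
  obtain ⟨hc, hfix⟩ := hasClasses_classRounds (primeAbove_spec _).1
    (s := s₁) (q := classPrime r κ Δ) (d := polyDegree r κ) (β := outBound r Δ)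
    (t := roundScale r Δ)
    ⟨fun v => (hp1.1 v).trans_le (hthr.trans (threshold_le_pow hΔ two_mul_le_classPrime)), hp1.2⟩
    hf1 hdeg (le_outBound_mul hΔ) (primeAbove_spec _).2
  set s₂ := execRounds G ((List.range (classPrime r κ Δ)).map
      (classRound (classPrime r κ Δ) (polyDegree r κ) (outBound r Δ))) s₁
  obtain ⟨hp, hl⟩ := properBelow_listRounds (primeAbove_spec _).1
    (s := s₂) (q := colorPrime r κ Δ) (Q := fieldScale r Δ) (d := polyDegree r κ)
    ⟨fun v => by
      rw [(hfix v).1]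
      exact (hp1.1 v).trans_le (hthr.trans (threshold_le_pow hΔ two_mul_le_colorPrime)),
      fun u v huv => by
        rw [(hfix u).1, (hfix v).1]
        exact hp1.2 u v huv⟩
    hc (fun v => (hfix v).2.1.trans (hf1 v).2.1) hdeg (le_max_left _ _)
    (le_fieldScale_mul_self hΔ) (primeAbove_spec _).2
  exact ⟨hp, fun v => ((hl v).trans (hfix v).2.2).trans (hf1 v).2.2⟩

theorem isTwoRulingSet_rulingProgram {V : Type*} {G : SimpleGraph V} [G.LocallyFinite]
    {r κ n m Δ : ℕ} (hr : 2 ≤ r) (hm : m ≤ n ^ κ) (hdeg : ∀ v, G.degree v ≤ Δ)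
    (c : G.Coloring (Fin m)) :
    IsTwoRulingSet G r {v | r ≤ (execRounds G (rulingProgram r κ m Δ)
      (fun v => startState r Δ (c v)) v).lvl} := by
  rcases Nat.eq_zero_or_pos Δ with rfl | hΔ
  · have hall : ∀ v, r ≤ (execRounds G (rulingProgram r κ m 0)
        (fun v => startState r 0 (c v)) v).lvl := fun v => by
      simp [rulingProgram, execRounds, startState]
    refine ⟨fun u _ v _ _ huv => ?_, fun v => ⟨v, hall v, by simp⟩⟩
    have h1 := hdeg u
    rw [← G.card_neighborFinset_eq_degree, Nat.le_zero, Finset.card_eq_zero] at h1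
    exact Finset.notMem_empty v (h1 ▸ (G.mem_neighborFinset u v).2 huv)
  · have hstart : ProperBelow G m (fun v => startState r Δ (c v)) :=
      ⟨fun v => (c v).2, fun u v huv h => c.valid huv (Fin.ext h)⟩
    have hlvl : ∀ v, (startState r Δ (c v)).lvl = 0 := fun v => if_neg hΔ.ne'
    have hfresh : Fresh (fun v => startState r Δ (c v)) := fun v => ⟨rfl, rfl, hlvl v⟩
    rw [rulingProgram, if_neg hΔ.ne']
    split_ifs with hsmall
    · exact isTwoRulingSet_rulingRounds (digitBase_pos hΔ)
        ⟨fun v => (hstart.1 v).trans_le hsmall, hstart.2⟩ hlvl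
    · rw [execRounds_append]
      obtain ⟨hp, hl⟩ := properBelow_coloringRounds (r := r) hΔ hm hdeg hstart hfresh
      exact isTwoRulingSet_rulingRounds (digitBase_pos hΔ)
        ⟨fun v => (hp.1 v).trans_le (colorPrime_sq_le hr hΔ), hp.2⟩ hl

/-- The factor of `roundScale r Δ` in the number of rounds. -/
def roundFactor (r κ : ℕ) : ℕ :=
  6 * (2 * polyDegree r κ + 1) + 1 + r * (16 * (polyDegree r κ + 1) ^ 2)

theorem length_rulingRounds (b r : ℕ) : (rulingRounds b r).length = r * b := by
  simp [rulingRounds, phaseRounds, List.length_flatMap]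

theorem length_rulingProgram_le {r κ n m Δ : ℕ} (hm : m ≤ n ^ κ) :
    ((rulingProgram r κ m Δ).length : ℝ) ≤
      (2 * roundFactor r κ : ℕ) * (Δ : ℝ) ^ (2 / ((r : ℝ) + 2)) + logStar n := by
  rcases Nat.eq_zero_or_pos Δ with rfl | hΔ
  · simp only [rulingProgram, if_true, List.length_nil, Nat.cast_zero]
    positivity
  -- Each class costs three rounds: one to try its value and two to color it. The single
  -- `adoptRound` is absorbed by `1 ≤ t`.
  have hnat : (rulingProgram r κ m Δ).length ≤
      roundFactor r κ * roundScale r Δ + logStar n := by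
    have ht := roundScale_pos (r := r) hΔ
    have hb : r * digitBase r κ Δ =
        r * (16 * (polyDegree r κ + 1) ^ 2) * roundScale r Δ := by
      rw [digitBase, ← mul_assoc]
    have hq := classPrime_le (r := r) (κ := κ) hΔ
    have hk := (linialCount_spec hΔ hm).1
    rw [rulingProgram, if_neg hΔ.ne', roundFactor, add_mul, add_mul, ← hb, one_mul]
    split_ifs with hsmall
    · rw [length_rulingRounds]
      omega
    · have hlist : (listRounds (classPrime r κ Δ) (colorPrime r κ Δ) (polyDegree r κ)
          (fieldScale r Δ)).length = classPrime r κ Δ * 2 + 1 := by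
        simp [listRounds, List.length_flatMap]
      rw [List.length_append, length_rulingRounds, coloringRounds, List.length_append,
        List.length_append, hlist, linialRounds, List.length_map, List.length_map,
        List.length_range, List.length_range, mul_assoc 6]
      omega
  have h1 : ((rulingProgram r κ m Δ).length : ℝ) ≤
      roundFactor r κ * roundScale r Δ + logStar n := by exact_mod_cast hnat
  have h2 := mul_le_mul_of_nonneg_left (roundScale_le (r := r) hΔ)
    (Nat.cast_nonneg (α := ℝ) (roundFactor r κ))
  push_cast
  linarith

/-! ### Message lengths -/

/-- The infimum of the empty set is `0`, so the bound holds even when no admissible choice exists.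
Entry bounds therefore need no correctness argument. -/
theorem sInf_lt_and_lt {q : ℕ} (hq : 0 < q) (P : ℕ → Prop) : sInf {x | x < q ∧ P x} < q := by
  rcases Set.eq_empty_or_nonempty {x | x < q ∧ P x} with h | h
  · rwa [h, Nat.sInf_empty]
  · exact (Nat.sInf_mem h).1

section Preserves

variable {N q d : ℕ}

theorem preserves_linialRound (hq : 0 < q) (hN : q ^ 2 ≤ N) :
    (linialRound q d).Preserves N := fun _ _ h =>
  ⟨(mul_add_lt_sq (sInf_lt_and_lt hq _) (digitPoly_lt hq _ _ _)).le.trans hN,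
    h.cls, h.time, h.shift, h.fin, h.lvl⟩

theorem preserves_classRound (hq : 0 < q) (hN : q ≤ N) {β x : ℕ} (hx : x ≤ N) :
    (classRound q d β x).Preserves N := fun s M h => by
  rw [classRound]
  split_ifs
  · exact ⟨h.col, (Nat.succ_le_of_lt (digitPoly_lt hq _ _ _)).trans hN, hx, h.shift, h.fin, h.lvl⟩
  · exact h

theorem preserves_shiftRound (hq : 0 < q) (hN : q ≤ N) {Q j : ℕ} :
    (shiftRound q d Q j).Preserves N := fun s M h => by
  rw [shiftRound]
  split_ifs
  · exact ⟨h.col, h.cls, h.time, (sInf_lt_and_lt hq _).le.trans hN, h.fin, h.lvl⟩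
  · exact h

theorem preserves_pickRound (hq : 0 < q) (hN : q ^ 2 ≤ N) {j : ℕ} :
    (pickRound q d j).Preserves N := fun s M h => by
  rw [pickRound]
  split_ifs
  · exact ⟨h.col, h.cls, h.time, h.shift, (Nat.succ_le_of_lt
      (mul_add_lt_sq (sInf_lt_and_lt hq _) (Nat.mod_lt _ hq))).trans hN, h.lvl⟩
  · exact h

theorem preserves_adoptRound : adoptRound.Preserves N := fun _ _ h =>
  ⟨(Nat.sub_le _ _).trans h.fin, h.cls, h.time, h.shift, h.fin, h.lvl⟩

theorem preserves_levelRound {b i j : ℕ} (hi : i + 1 ≤ N) :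
    (levelRound b i j).Preserves N := fun s M h => by
  rw [levelRound]
  split_ifs
  · exact ⟨h.col, h.cls, h.time, h.shift, h.fin, hi⟩
  · exact h

end Preserves

theorem preserves_rulingRounds {N b r : ℕ} (hN : r ≤ N) :
    ∀ R ∈ rulingRounds b r, R.Preserves N := by
  intro R hR
  obtain ⟨i, hi, hR⟩ := List.mem_flatMap.1 hR
  obtain ⟨j, -, rfl⟩ := List.mem_map.1 hR
  exact preserves_levelRound ((Nat.succ_le_of_lt (List.mem_range.1 hi)).trans hN)

theorem preserves_coloringRounds {r κ n m Δ N : ℕ} (hΔ : 1 ≤ Δ) (hm : m ≤ n ^ κ)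
    (h1 : n ^ (κ + 3) ≤ N) (h2 : thresholdFactor κ * Δ ^ 8 ≤ N) (h3 : classPrime r κ Δ ≤ N)
    (h4 : colorPrime r κ Δ ^ 2 ≤ N) : ∀ R ∈ coloringRounds r κ m Δ, R.Preserves N := by
  intro R hR
  obtain ⟨-, hthr, hbig⟩ := linialCount_spec hΔ hm
  rw [coloringRounds, List.mem_append, List.mem_append, listRounds, List.mem_append] at hR
  rcases hR with hR | hR | hR | hR
  · obtain ⟨i, hi, rfl⟩ := List.mem_map.1 hR
    have hi := List.mem_range.1 hi
    refine preserves_linialRound (primeAbove_spec _).1.pos ?_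
    change linialNext Δ _ ≤ N
    rw [← Function.iterate_succ_apply' (linialNext Δ)]
    rcases Nat.lt_or_ge (i + 1) (linialCount κ Δ m) with h | h
    · exact (hbig _ h).trans h1
    · rw [show i.succ = linialCount κ Δ m by omega]
      exact hthr.trans h2
  · obtain ⟨x, hx, rfl⟩ := List.mem_map.1 hR
    exact preserves_classRound (primeAbove_spec _).1.pos h3
      ((List.mem_range.1 hx).le.trans h3)
  · obtain ⟨j, -, hR⟩ := List.mem_flatMap.1 hR
    rw [List.mem_pair] at hR
    rcases hR with rfl | rfl
    · exact preserves_shiftRound (primeAbove_spec _).1.pos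
        ((Nat.le_self_pow (by norm_num) _).trans h4)
    · exact preserves_pickRound (primeAbove_spec _).1.pos h4
  · rw [List.mem_singleton.1 hR]
    exact preserves_adoptRound

/-- The factor in the bound for the entries of the states. -/
def entryFactor (r κ : ℕ) : ℕ :=
  r + 3 + thresholdFactor κ + 2 * (2 * polyDegree r κ + 1)

/-- If the coloring is skipped, the entries are only input colors and levels, whatever `Δ` is.
Otherwise `digitBase r κ Δ ^ r < m ≤ n ^ κ` bounds `Δ`, `t` and the squared color prime by a power
of `n`. -/
theorem exists_entry_bound {r κ n m Δ : ℕ} (hr : 2 ≤ r) (hn : 1 ≤ n) (hm : m ≤ n ^ κ) :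
    ∃ N, 1 ≤ N ∧ N + 1 ≤ entryFactor r κ * n ^ (8 * (κ + 3)) ∧
      (∀ R ∈ rulingProgram r κ m Δ, R.Preserves N) ∧
      ∀ c < m, (startState r Δ c).Bounded N := by
  set W := n ^ (κ + 3) with hW
  have hW1 : 1 ≤ W := Nat.one_le_pow _ _ hn
  have hW8 : W ^ 8 = n ^ (8 * (κ + 3)) := by rw [hW, ← pow_mul, mul_comm]
  have hWle : W ≤ W ^ 8 := Nat.le_self_pow (by norm_num) _
  have hmW : m ≤ W := hm.trans (Nat.pow_le_pow_right hn (by omega))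
  have hstart : ∀ {N}, W + r ≤ N → ∀ c < m, (startState r Δ c).Bounded N := by
    intro N hN c hc
    refine ⟨by simp only [startState]; omega, Nat.zero_le _, Nat.zero_le _, Nat.zero_le _,
      Nat.zero_le _, ?_⟩
    simp only [startState]
    split_ifs <;> omega
  by_cases hcase : Δ = 0 ∨ m ≤ digitBase r κ Δ ^ r
  · refine ⟨W + r, by omega, ?_, ?_, hstart le_rfl⟩
    · rw [← hW8, entryFactor]
      nlinarith
    · intro R hR
      rw [rulingProgram] at hR
      split_ifs at hR with h1 h2
      · simp at hR
      · exact preserves_rulingRounds (by omega) R hR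
      · exact absurd hcase (by tauto)
  · rw [not_or, not_le] at hcase
    have hΔ : 1 ≤ Δ := Nat.one_le_iff_ne_zero.2 hcase.1
    have hΔW : Δ ≤ W := (le_digitBase_pow (κ := κ) hr hΔ).trans (hcase.2.le.trans hmW)
    have htW : roundScale r Δ ≤ W :=
      (roundScale_le_digitBase_pow (κ := κ) hr).trans (hcase.2.le.trans hmW)
    have hcW : colorPrime r κ Δ ^ 2 ≤ W := (colorPrime_sq_le hr hΔ).trans (hcase.2.le.trans hmW)
    have hqW := classPrime_le (r := r) (κ := κ) hΔ
    refine ⟨W + r + thresholdFactor κ * Δ ^ 8 + classPrime r κ Δ, by omega, ?_, ?_,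
      hstart (by omega)⟩
    · have e1 := Nat.mul_le_mul_left (thresholdFactor κ) (Nat.pow_le_pow_left hΔW 8)
      have e2 : 2 * ((2 * polyDegree r κ + 1) * roundScale r Δ) ≤
          2 * (2 * polyDegree r κ + 1) * W ^ 8 := by
        rw [← mul_assoc]
        exact Nat.mul_le_mul_left _ (htW.trans hWle)
      have e3 : r ≤ r * W ^ 8 := Nat.le_mul_of_pos_right _ (by positivity)
      rw [← hW8, entryFactor]
      calc W + r + thresholdFactor κ * Δ ^ 8 + classPrime r κ Δ + 1
          ≤ W ^ 8 + r * W ^ 8 + thresholdFactor κ * W ^ 8 +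
            2 * (2 * polyDegree r κ + 1) * W ^ 8 + W ^ 8 := by omega
        _ = (r + 2 + thresholdFactor κ + 2 * (2 * polyDegree r κ + 1)) * W ^ 8 := by ring
        _ ≤ _ := Nat.mul_le_mul_right _ (by omega)
    · intro R hR
      rw [rulingProgram, if_neg hcase.1, if_neg (not_le.2 hcase.2), List.mem_append] at hR
      rcases hR with hR | hR
      · exact preserves_coloringRounds hΔ hm (by omega) (by omega) (by omega) (by omega) R hR
      · exact preserves_rulingRounds (by omega) R hR

/-! ### The main theorem -/

theorem theorem4 (r : ℕ) (hr : 2 ≤ r) (κ : ℕ) :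
    ∃ (A : DistAlgorithm) (K B : ℝ),
      ∀ (V : Type*) [Fintype V] (G : SimpleGraph V) [DecidableRel G.Adj] (p : PortNumbering G)
        (Δ m : ℕ) (c : G.Coloring (Fin m)),
        G.maxDegree ≤ Δ → m ≤ Fintype.card V ^ κ →
          A.MessageBitsLE G p c Δ (B * Real.logb 2 (Fintype.card V)) ∧
          ∃ (T : ℕ) (S : Set V),
            (T : ℝ) ≤ K * (Δ : ℝ) ^ (2 / ((r : ℝ) + 2)) + logStar (Fintype.card V) ∧
            A.ComputesSetIn G p c Δ T S ∧ IsTwoRulingSet G r S := by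
  refine ⟨DistAlgorithm.ofProgram (rulingProgram r κ) (startState r) (fun s => decide (r ≤ s.lvl)),
    (2 * roundFactor r κ : ℕ),
    32 * (Real.logb 2 (entryFactor r κ) + (8 * (κ + 3) : ℕ)) + 1, ?_⟩
  intro V _ G _ p Δ m c hmax hm
  have hdeg : ∀ v, G.degree v ≤ Δ := fun v => (G.degree_le_maxDegree v).trans hmax
  refine ⟨fun t v i => ?_, (rulingProgram r κ m Δ).length, _, length_rulingProgram_le hm,
    DistAlgorithm.computesSetIn_ofProgram G _ _ _ p c Δ, ?_⟩
  · set n := Fintype.card V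
    -- A message needs a port, so the graph has an edge. Hence `1 ≤ log₂ n`, which lets additive
    -- constants be absorbed into `B`.
    have hn : 2 ≤ n := by
      have h1 : 0 < G.degree v := i.pos
      have h2 := G.degree_lt_card_verts v
      omega
    obtain ⟨N, hN1, hN, hprog, hstart⟩ := exists_entry_bound (Δ := Δ) hr (by omega : 1 ≤ n) hm
    refine (DistAlgorithm.messageBitsLE_ofProgram G (rulingProgram r κ) (startState r)
      (fun s => decide (r ≤ s.lvl)) p c Δ hN1 hprog (fun v => hstart _ (c v).2) t v i).trans ?_
    have hE : 1 ≤ entryFactor r κ := by unfold entryFactor; omega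
    have hE' : (1 : ℝ) ≤ entryFactor r κ := by exact_mod_cast hE
    have hn' : (2 : ℝ) ≤ n := by exact_mod_cast hn
    have hlogn : 1 ≤ Real.logb 2 n := by
      rw [Real.le_logb_iff_rpow_le (by norm_num) (by linarith), Real.rpow_one]
      exact hn'
    have hlogE : 0 ≤ Real.logb 2 (entryFactor r κ) := Real.logb_nonneg (by norm_num) hE'
    have hlog : Real.logb 2 (N + 1 : ℕ) ≤
        Real.logb 2 (entryFactor r κ) + (8 * (κ + 3) : ℕ) * Real.logb 2 n := by
      rw [← Real.logb_pow, ← Real.logb_mul (by linarith) (by positivity)]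
      exact Real.logb_le_logb_of_le (by norm_num) (by positivity) (by exact_mod_cast hN)
    nlinarith [mul_nonneg hlogE (by linarith : 0 ≤ Real.logb 2 n - 1)]
  · simpa only [decide_eq_true_eq] using isTwoRulingSet_rulingProgram (Δ := Δ) hr hm hdeg c
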